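/- Let $q=p_1^{r_1}\cdots p_t^{r_t}$ with $p_1,\dots,p_t$ distinct odd primes and $r_j\ge 1$. Put $P_j=p_j^{r_j}$, $n=P_1+\cdots+P_t$ and $n_j=P_1+\cdots+P_j$ ($n_0=0$). Let $B_n$ be the Artin braid group with standard generators $\sigma_1,\dots,\sigma_{n-1}$, let $P_n$ be the pure braid group, and let $\overline\sigma\colon B_n/[P_n,P_n]\to S_n$ be the homomorphism induced by $\sigma_i\mapsto(i,i+1)$. In $B_n/[P_n,P_n]$ put $$A_{i,j}=\sigma_{j-1}\cdots\sigma_{i+1}\sigma_i^2\sigma_{i+1}^{-1}\cdots\sigma_{j-1}^{-1}\quad(1\le i<j\le n),$$ $$\delta_{m,z}=\sigma_{m+z-1}\cdots\sigma_{m+\frac{z+1}{2}}\,\sigma_{m+\frac{z-1}{2}}^{-1}\cdots\sigma_{m+1}^{-1}\quad(z\text{ odd}),\qquad \delta=\delta_{n_0,P_1}\delta_{n_1,P_2}\cdots\delta_{n_{t-1},P_t}.$$ Let $\Gamma_q\le B_n/[P_n,P_n]$ be the subgroup generated by the elements $A_{n_{j-1}+1,n_{j-1}+2}\,\delta_{n_{j-1},P_j}$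 ($1\le j\le t$) and $A_{r,s}^q$ ($1\le r<s\le n$), and let $L=\Gamma_q\cap\ker\overline\sigma$. Then $L$ is a free abelian group of rank $n(n-1)/2$. The group $\Gamma_q/L$ is cyclic of order $q$, generated by the element $\theta$ whose image under the embedding $\Gamma_q/L\hookrightarrow S_n$ is $\overline\sigma(\delta)$. The holonomy representation $\psi_q\colon\Gamma_q/L\to\operatorname{Aut}(L)$, $\psi_q(\pi L)(x)=\pi x\pi^{-1}$, is well defined and faithful. The following elements, listed in this order (the families (a) and (b) together lexicographically in $(j,h,k)$, then the family (c) lexicographically in $(j,h,k)$), form a $\mathbb Z$-basis $\mathcal B$ of $L$: (a) for $1\le j\le t$ and $h=0$: $e_{j,0,1}=(A_{n_{j-1}+1,n_{j-1}+2}\,\delta_{n_{j-1},P_j})^{P_j}$, and $e_{j,0,k+1}=\delta^{k-1}A_{n_{j-1}+2,n_{j-1}+3}^{q}\delta^{-(k-1)}$ for $1\le k\le P_j-1$; (b) for $1\le j\le t$ and $1\le h\le\frac{P_j-3}{2}$: $e_{j,h,k}=\delta^{k-1}A_{n_{j-1}+1,n_{j-1}+h+2}^{q}\delta^{-(k-1)}$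 for $1\le k\le P_j$; (c) for $1\le j<h\le t$: $\delta^{k-1}A_{n_{j-1}+1,n_{h-1}+1}^{q}\delta^{-(k-1)}$ for $1\le k\le P_jP_h$. In this basis (with the coordinates of the images of the basis vectors as columns), $$[\psi_q(\theta)]_{\mathcal B}=\bigoplus_{1\le j\le t}\Bigl(\mathcal N_{P_j}[q]\oplus\bigoplus_{1\le h\le\frac{P_j-3}{2}}\mathcal M_{P_j}\Bigr)\oplus\bigoplus_{1\le j<h\le t}\mathcal M_{P_jP_h}.$$ Here $\mathcal M_z$ is the $z\times z$ cyclic permutation matrix whose column $k$ is the $(k+1)$-st standard vector for $k<z$ and whose column $z$ is the first standard vector; $\mathcal N_z[q]$ is the $z\times z$ matrix whose first column is the first standard vector, whose column $k$ is the $(k+1)$-st standard vector for $2\le k<z$, and whose last column is $(q,-1,\dots,-1)^{T}$. In particular, for $q=3$ the matrix is $$\mathcal N_3[3]=\begin{pmatrix}1&0&3\\0&0&-1\\0&1&-1\end{pmatrix}.$$ The characteristic polynomial of $[\psi_q(\theta)]_{\mathcal B}$ is $$\prod_{1\le j\le t}\bigl(x^{P_j}-1\bigr)^{\frac{P_j-1}{2}}\cdot\prod_{1\le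 j<h\le t}\bigl(x^{P_jP_h}-1\bigr).$$ -/

import Mathlib

namespace BraidHolonomy

open scoped commutatorElement

/-! ### Artin braid groups and the quotient `B_n / [P_n, P_n]` -/

/-- The Artin relations. The generator with index `i : Fin (n - 1)` is `σ_{i+1}`. -/
def braidRels (n : ℕ) : Set (FreeGroup (Fin (n - 1))) :=
  {w | ∃ i j : Fin (n - 1), i.val + 2 ≤ j.val ∧
      w = FreeGroup.of i * FreeGroup.of j * (FreeGroup.of j * FreeGroup.of i)⁻¹} ∪
  {w | ∃ i j : Fin (n - 1), j.val = i.val + 1 ∧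
      w = FreeGroup.of j * FreeGroup.of i * FreeGroup.of j *
        (FreeGroup.of i * FreeGroup.of j * FreeGroup.of i)⁻¹}

/-- The Artin braid group `B_n` on `n` strings. -/
abbrev BraidGroup (n : ℕ) : Type := PresentedGroup (braidRels n)

/-- The transposition exchanging the `(i+1)`-st and the `(i+2)`-nd string. -/
def adjSwap (n : ℕ) (i : Fin (n - 1)) : Equiv.Perm (Fin n) :=
  Equiv.swap ⟨i.val, by omega⟩ ⟨i.val + 1, by omega⟩

theorem adjSwap_rels (n : ℕ) :
    ∀ w ∈ braidRels n, FreeGroup.lift (adjSwap n) w = 1 := by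
  rintro w (⟨i, j, hij, rfl⟩ | ⟨i, j, hij, rfl⟩)
  · simp only [map_mul, map_inv, FreeGroup.lift_apply_of]
    rw [mul_inv_eq_one]
    refine (Equiv.Perm.Disjoint.commute ?_).eq
    intro x
    by_cases hx : x.val = i.val ∨ x.val = i.val + 1
    · right
      apply Equiv.swap_apply_of_ne_of_ne <;> (intro h; rw [Fin.ext_iff] at h; simp at h; omega)
    · left
      apply Equiv.swap_apply_of_ne_of_ne <;> (intro h; rw [Fin.ext_iff] at h; simp at h; omega)
  · simp only [map_mul, map_inv, FreeGroup.lift_apply_of]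
    rw [mul_inv_eq_one]
    obtain ⟨i, hi⟩ := i
    obtain ⟨j, hj⟩ := j
    simp only at hij
    subst hij
    have h1 : (⟨i, by omega⟩ : Fin n) ≠ ⟨i + 1, by omega⟩ := by simp
    have h2 : (⟨i, by omega⟩ : Fin n) ≠ ⟨i + 1 + 1, by omega⟩ := by simp; omega
    have h3 : (⟨i + 1, by omega⟩ : Fin n) ≠ ⟨i + 1 + 1, by omega⟩ := by simp
    simp only [adjSwap]
    rw [Equiv.swap_mul_swap_mul_swap h1 h2]
    rw [Equiv.swap_comm (⟨i, _⟩ : Fin n) ⟨i + 1, _⟩,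
      Equiv.swap_comm (⟨i + 1, _⟩ : Fin n) ⟨i + 1 + 1, _⟩]
    rw [Equiv.swap_mul_swap_mul_swap h3.symm h2.symm]
    rw [Equiv.swap_comm]

/-- The homomorphism `B_n → S_n`, `σ_i ↦ (i, i+1)`. -/
def braidPerm (n : ℕ) : BraidGroup n →* Equiv.Perm (Fin n) :=
  PresentedGroup.toGroup (adjSwap_rels n)

/-- The pure braid group `P_n`. -/
abbrev pureBraid (n : ℕ) : Subgroup (BraidGroup n) := (braidPerm n).ker

/-- The group `B_n / [P_n, P_n]`. -/
abbrev CrystBraid (n : ℕ) : Type := BraidGroup n ⧸ ⁅pureBraid n, pureBraid n⁆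

/-- The induced homomorphism `σ̄ : B_n / [P_n, P_n] → S_n`. -/
def crystPerm (n : ℕ) : CrystBraid n →* Equiv.Perm (Fin n) :=
  QuotientGroup.lift _ (braidPerm n)
    (fun _ hx => Subgroup.commutator_le_left (pureBraid n) (pureBraid n) hx)

/-- The image of `σ_i` (`1 ≤ i ≤ n - 1`) in `B_n / [P_n, P_n]`; the value is `1` for
other `i`, which never occur below. -/
def sig (n i : ℕ) : CrystBraid n :=
  if h : 1 ≤ i ∧ i < n then
    QuotientGroup.mk (PresentedGroup.of (⟨i - 1, by omega⟩ : Fin (n - 1)))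
  else 1

/-- `A_{i,j} = σ_{j-1} ⋯ σ_{i+1} σ_i² σ_{i+1}⁻¹ ⋯ σ_{j-1}⁻¹` for `1 ≤ i < j ≤ n`. -/
def pureGen (n i j : ℕ) : CrystBraid n :=
  ((List.range (j - 1 - i)).map fun k => sig n (j - 1 - k)).prod * sig n i ^ 2 *
    (((List.range (j - 1 - i)).map fun k => sig n (j - 1 - k)).prod)⁻¹

/-- `δ_{m,z} = σ_{m+z-1} ⋯ σ_{m+(z+1)/2} σ_{m+(z-1)/2}⁻¹ ⋯ σ_{m+1}⁻¹` for odd `z`. -/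
def deltaBlock (n m z : ℕ) : CrystBraid n :=
  ((List.range ((z - 1) / 2)).map fun k => sig n (m + z - 1 - k)).prod *
    ((List.range ((z - 1) / 2)).map fun k => (sig n (m + (z - 1) / 2 - k))⁻¹).prod

/-! ### The group `Γ_q`

The prime powers are `P 0, …, P (t-1)`; they partition the `n` strings into consecutive
blocks of these sizes. -/

variable {t : ℕ} (P : Fin t → ℕ)

/-- The number of strings `n`, the sum of the prime powers. -/
abbrev strands : ℕ := ∑ i, P i

/-- The order `q` of the holonomy group, the product of the prime powers. -/
abbrev order : ℕ := ∏ i, P i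

/-- The number of strings preceding block `j`. -/
def offset (j : Fin t) : ℕ := ∑ i ∈ Finset.Iio j, P i

/-- The element `δ_{n_j, P_j}` attached to block `j`. -/
def deltaAt (j : Fin t) : CrystBraid (strands P) := deltaBlock (strands P) (offset P j) (P j)

/-- `δ`, the product of the elements attached to the blocks. -/
def delta : CrystBraid (strands P) := (List.ofFn fun j : Fin t => deltaAt P j).prod

/-- `A_{n_j+1, n_j+2} δ_{n_j, P_j}`, where `n_j` is the number of strings preceding
block `j`. -/
def twist (j : Fin t) : CrystBraid (strands P) :=
  pureGen (strands P) (offset P j + 1) (offset P j + 2) * deltaAt P j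

/-- `Γ_q`, generated by the elements `A_{n_j+1, n_j+2} δ_{n_j, P_j}` and by the `q`-th
powers of all `A_{r,s}`. -/
def Gam : Subgroup (CrystBraid (strands P)) :=
  Subgroup.closure (Set.range (twist P) ∪
    {x | ∃ r s : ℕ, 1 ≤ r ∧ r < s ∧ s ≤ strands P ∧ x = pureGen (strands P) r s ^ order P})

/-- The restriction of `σ̄` to `Γ_q`. -/
def gamPerm : Gam P →* Equiv.Perm (Fin (strands P)) :=
  (crystPerm (strands P)).comp (Gam P).subtype

/-- The lattice `L = Γ_q ∩ ker σ̄`, as a subgroup of `Γ_q`. -/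
abbrev lattice : Subgroup (Gam P) := (gamPerm P).ker

/-- The holonomy group `Γ_q / L`. -/
abbrev Holonomy : Type := Gam P ⧸ lattice P

/-- The embedding of the holonomy group into `S_n` induced by `σ̄`. -/
def holonomyPerm : Holonomy P →* Equiv.Perm (Fin (strands P)) :=
  QuotientGroup.kerLift (gamPerm P)

theorem ker_crystPerm_comm {n : ℕ} {a b : CrystBraid n}
    (ha : a ∈ (crystPerm n).ker) (hb : b ∈ (crystPerm n).ker) : a * b = b * a := by
  induction a using QuotientGroup.induction_on with
  | H x =>
  induction b using QuotientGroup.induction_on with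
  | H y =>
  have hx : x ∈ pureBraid n := ha
  have hy : y ∈ pureBraid n := hb
  rw [← QuotientGroup.mk_mul, ← QuotientGroup.mk_mul, eq_comm, QuotientGroup.eq]
  have : (y * x)⁻¹ * (x * y) = ⁅x⁻¹, y⁻¹⁆ := by
    simp only [commutatorElement_def]; group
  rw [this]
  exact Subgroup.commutator_mem_commutator (inv_mem hx) (inv_mem hy)

instance latticeCommGroup : CommGroup (lattice P) :=
  { (inferInstance : Group (lattice P)) with
    mul_comm := fun a b => by
      apply Subtype.ext
      apply Subtype.ext
      exact ker_crystPerm_comm a.2 b.2 }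

/-- The action of the holonomy group on `L` by conjugation, `π L ↦ (x ↦ π x π⁻¹)`. -/
def holonomyAut : Holonomy P →* MulAut (lattice P) :=
  QuotientGroup.lift (lattice P) MulAut.conjNormal (by
    intro g hg
    ext x
    have h := congrArg (fun z : lattice P => (z : Gam P)) (mul_comm (⟨g, hg⟩ : lattice P) x)
    have h' : g * (x : Gam P) = x * g := h
    simp [h'])

/-- The holonomy representation `ψ_q` on the lattice `L`, written additively. -/
def holonomyRep : Representation ℤ (Holonomy P) (Additive (lattice P)) where
  toFun x := (MonoidHom.toAdditive (holonomyAut P x).toMonoidHom).toIntLinearMap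
  map_one' := by ext x; simp
  map_mul' a b := by ext x; simp

/-! ### The ordered basis and the block matrices -/

/-- The blocks of the decomposition, in order: the pairs `(j, h)` with
`0 ≤ h ≤ (P_j - 3)/2` in lexicographic order, followed by the pairs `j < h` of indices
in lexicographic order. -/
abbrev BlockIdx : Type := (Σ j : Fin t, Fin ((P j - 1) / 2)) ⊕ {x : Fin t × Fin t // x.1 < x.2}

/-- The size of each block. -/
def blockSize : BlockIdx P → ℕ
  | Sum.inl b => P b.1
  | Sum.inr b => P b.1.1 * P b.1.2

/-- The index set of the basis: a block, and a position `k` inside it (counted from `0`). -/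
abbrev BasisIdx : Type := Σ b : BlockIdx P, Fin (blockSize P b)

/-- The conjugate `δ^k x δ^{-k}`. -/
def conjDelta (k : ℕ) (x : CrystBraid (strands P)) : CrystBraid (strands P) :=
  delta P ^ k * x * (delta P ^ k)⁻¹

/-- The elements of the ordered basis. With `n_j` the number of strings preceding block `j`
and positions `k` counted from `0`, they are
* for `(j, 0)`: `(A_{n_j+1,n_j+2} δ_{n_j,P_j})^{P_j}` at `k = 0`, and
  `δ^{k-1} A_{n_j+2,n_j+3}^q δ^{-(k-1)}` at `1 ≤ k < P_j`;
* for `(j, h)`, `h ≥ 1`: `δ^k A_{n_j+1,n_j+h+2}^q δ^{-k}`;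
* for `j < h`: `δ^k A_{n_j+1,n_h+1}^q δ^{-k}`. -/
def basisElt : (b : BlockIdx P) → ℕ → CrystBraid (strands P)
  | Sum.inl ⟨j, h⟩, k =>
      if h.val = 0 then
        if k = 0 then twist P j ^ P j
        else conjDelta P (k - 1)
          (pureGen (strands P) (offset P j + 2) (offset P j + 3) ^ order P)
      else conjDelta P k
        (pureGen (strands P) (offset P j + 1) (offset P j + h.val + 2) ^ order P)
  | Sum.inr x, k =>
      conjDelta P k
        (pureGen (strands P) (offset P x.1.1 + 1) (offset P x.1.2 + 1) ^ order P)

/-- The cyclic permutation matrix `M_z`: ones just below the diagonal and in the upper right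
corner, zeros elsewhere. -/
def matM (z : ℕ) : Matrix (Fin z) (Fin z) ℤ :=
  Matrix.of fun i k => if i.val = (k.val + 1) % z then 1 else 0

/-- The matrix `N_z[q]`: the last column is `(q, -1, …, -1)`, the first column is
`(1, 0, …, 0)`, and every other column (index `k`, counted from `0`) has a single `1`,
just below the diagonal. -/
def matN (z : ℕ) (q : ℤ) : Matrix (Fin z) (Fin z) ℤ :=
  Matrix.of fun i k =>
    if k.val + 1 = z then (if i.val = 0 then q else -1)
    else if k.val = 0 then (if i.val = 0 then 1 else 0)
    else if i.val = k.val + 1 then 1 else 0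

/-- The diagonal blocks: `N_{P_j}[q]` for `(j, 0)`, `M_{P_j}` for `(j, h)` with `h ≥ 1`, and
`M_{P_j P_h}` for `j < h`. -/
def blockMat : (b : BlockIdx P) → Matrix (Fin (blockSize P b)) (Fin (blockSize P b)) ℤ
  | Sum.inl ⟨j, h⟩ => if h.val = 0 then matN (P j) (order P) else matM (P j)
  | Sum.inr x => matM (P x.1.1 * P x.1.2)

end BraidHolonomy

namespace BraidHolonomy

/-! An element of B_n/[P_n,P_n] is studied through two invariants: its permutation of the strings
and, for every unordered pair of strings, the signed number of their crossings (`wind`). Together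
they form a homomorphism to the semidirect product of the free abelian group on pairs with the
permutations (`crystWind`), so `wind` is a cocycle, and conjugation acts on pure elements by
permuting pairs (`wind_conj`). The two invariants determine the element (`ext_wind`): by the Coxeter
presentation of the symmetric group the A_{i,j} generate the kernel of the permutation map
(`mem_pureGenSubgroup`), they commute, and the winding vector of A_{i,j} is twice the pair {i,j}.

In these coordinates δ rotates every block by one step. Within a block, the crossings of δ at cyclic
distances d and P_j - d have opposite signs, so they cancel when summed over all rotations
(`sum_pairAct_wind_deltaBlock`). Hence the P_j-th power of a twist A_{n_j+1,n_j+2} δ_{n_j,P_j} has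
as winding vector twice the sum of the cyclically adjacent pairs of its block (`wind_twist_pow`),
which the rotation fixes. Modulo these vectors and 2q times the pairs, every element of Γ_q looks
like a power of the product of the twists (`exists_zpow_of_mem_Gam`); therefore they span the
winding vectors of L (`wind_mem_windLattice`).

The rotation splits the pairs into orbits: one of length P_j for each block and each distance from 1
to (P_j - 1)/2, and, by coprimality, a single one of length P_j P_h for each two blocks. The vectors
2q times a pair of one orbit are permuted cyclically, which gives the matrices M. In an orbit of
distance 1, one of these vectors is replaced by the orbit sum divided by q; expressing the replaced
vector gives the last column of N (`single_pairOf_baseBlock`). Over the rationals N and M are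
conjugate (`matN_mul_intertwiner`), so every block of size z has characteristic polynomial x^z - 1.
-/

/-- The product `s m * s (m - 1) * ⋯ * s (m - l + 1)`. -/
def desc {G : Type*} [Monoid G] (s : ℕ → G) (m l : ℕ) : G :=
  ((List.range l).map fun k => s (m - k)).prod

/-! ### Descending products and the Coxeter presentation of the symmetric group -/

section Desc
variable {G : Type*} [Group G] (s : ℕ → G)

@[simp] theorem desc_zero (m : ℕ) : desc s m 0 = 1 := rfl

theorem desc_succ (m l : ℕ) : desc s m (l + 1) = desc s m l * s (m - l) := by
  simp [desc, List.range_succ]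

theorem desc_succ' (m l : ℕ) : desc s (m + 1) (l + 1) = s (m + 1) * desc s m l := by
  induction l with
  | zero => simp [desc_succ]
  | succ l ih =>
    rw [desc_succ, ih, desc_succ s m l, mul_assoc, Nat.add_sub_add_right]

/-- The relations of the symmetric group hold for `s 1, …, s (n - 1)`. -/
structure IsCoxeterFamily (n : ℕ) : Prop where
  comm : ∀ i j, 1 ≤ i → i + 2 ≤ j → j < n → s i * s j = s j * s i
  braid : ∀ i, 1 ≤ i → i + 1 < n → s (i + 1) * s i * s (i + 1) = s i * s (i + 1) * s i
  sq : ∀ i, 1 ≤ i → i < n → s i * s i = 1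

variable {s} {n : ℕ}

theorem desc_mul_of_lt (h : ∀ i j, 1 ≤ i → i + 2 ≤ j → j < n → s i * s j = s j * s i)
    {m i : ℕ} (hm : m < n) (hi : 1 ≤ i) :
    ∀ l, i + l < m → desc s m l * s i = s i * desc s m l
  | 0, _ => by simp
  | l + 1, hl => by
    rw [desc_succ, mul_assoc, ← h i (m - l) hi (by omega) (by omega), ← mul_assoc,
      desc_mul_of_lt h hm hi l (by omega), mul_assoc]

/-- Here both `i` and `i - 1` index factors of the product. The letter `s i` passes the smaller
factors, the braid relation turns `s i * s (i - 1) * s i` into `s (i - 1) * s i * s (i - 1)`, and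
the new first letter passes the larger factors. -/
theorem IsCoxeterFamily.desc_mul_of_gt (hs : IsCoxeterFamily s n) {m i : ℕ} (hm : m < n)
    (him : i ≤ m) : ∀ l, l ≤ m → m + 1 < i + l → desc s m l * s i = s (i - 1) * desc s m l
  | 0, _, hl => by omega
  | 1, _, hl => by omega
  | l + 2, hlm, hl => by
    rcases Nat.lt_or_ge (m + 1) (i + (l + 1)) with h | h
    · rw [desc_succ, mul_assoc, hs.comm (m - (l + 1)) i (by omega) (by omega) (by omega),
        ← mul_assoc, hs.desc_mul_of_gt hm him (l + 1) (by omega) h, mul_assoc]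
    · obtain ⟨k, rfl⟩ : ∃ k, i = k + 1 := ⟨i - 1, by omega⟩
      have e1 : m - (l + 1) = k := by omega
      have e2 : m - l = k + 1 := by omega
      rw [desc_succ, desc_succ, e1, e2]
      have := hs.braid k (by omega) (by omega)
      rw [mul_assoc (desc s m l), mul_assoc, this, ← mul_assoc, ← mul_assoc,
        desc_mul_of_lt hs.comm hm (by omega) l (by omega)]
      simp [mul_assoc]

/-- The products `desc s m l` represent the right cosets of the subgroup on the first `m - 1`
generators. Right multiplication by `s i` lengthens the product if `i = m - l`, shortens it if `i =
m - l + 1`, and otherwise passes a generator of the subgroup to the left. -/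
theorem IsCoxeterFamily.exists_desc (hs : IsCoxeterFamily s n) {m : ℕ} (hm : m < n) {x : G}
    (hx : x ∈ Subgroup.closure {g | ∃ i, 1 ≤ i ∧ i < m + 1 ∧ g = s i}) :
    ∃ y ∈ Subgroup.closure {g | ∃ i, 1 ≤ i ∧ i < m ∧ g = s i}, ∃ l ≤ m, x = y * desc s m l := by
  have key : ∀ y ∈ Subgroup.closure {g | ∃ i, 1 ≤ i ∧ i < m ∧ g = s i}, ∀ l ≤ m, ∀ i, 1 ≤ i →
      i < m + 1 → ∃ y' ∈ Subgroup.closure {g | ∃ i, 1 ≤ i ∧ i < m ∧ g = s i}, ∃ l' ≤ m,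
        y * desc s m l * s i = y' * desc s m l' := by
    intro y hy l hl i hi him
    rcases lt_trichotomy (i + l) m with h | h | h
    · refine ⟨y * s i, mul_mem hy (Subgroup.subset_closure ⟨i, hi, by omega, rfl⟩), l, hl, ?_⟩
      rw [mul_assoc, desc_mul_of_lt hs.comm hm hi l h, mul_assoc]
    · refine ⟨y, hy, l + 1, by omega, ?_⟩
      rw [desc_succ, mul_assoc, ← h, Nat.add_sub_cancel]
    · rcases Nat.lt_or_ge (m + 1) (i + l) with h' | h'
      · refine ⟨y * s (i - 1),
          mul_mem hy (Subgroup.subset_closure ⟨i - 1, by omega, by omega, rfl⟩), l, hl, ?_⟩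
        rw [mul_assoc, hs.desc_mul_of_gt hm (by omega) l hl h', mul_assoc]
      · obtain ⟨l, rfl⟩ : ∃ k, l = k + 1 := ⟨l - 1, by omega⟩
        refine ⟨y, hy, l, by omega, ?_⟩
        have e : m - l = i := by omega
        rw [desc_succ, e, mul_assoc, mul_assoc, hs.sq i hi (by omega), mul_one]
  induction hx using Subgroup.closure_induction_right with
  | one => exact ⟨1, one_mem _, 0, by omega, by simp⟩
  | mul_right x hx g hg ih =>
    obtain ⟨y, hy, l, hl, rfl⟩ := ih
    obtain ⟨i, hi, him, rfl⟩ := hg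
    exact key y hy l hl i hi him
  | mul_inv_cancel x hx g hg ih =>
    obtain ⟨y, hy, l, hl, rfl⟩ := ih
    obtain ⟨i, hi, him, rfl⟩ := hg
    rw [inv_eq_of_mul_eq_one_left (hs.sq i hi (by omega))]
    exact key y hy l hl i hi him

variable {π : G →* Equiv.Perm ℕ}

/-- Descending products act as cycles: `m - l` goes to `m` and the strings above it, up to `m`, move
down by one. -/
theorem perm_desc_apply (hπ : ∀ i, 1 ≤ i → i < n → π (s i) = Equiv.swap (i - 1) i)
    {m : ℕ} (hm : m < n) : ∀ l ≤ m, π (desc s m l) (m - l) = m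
  | 0, _ => by simp
  | l + 1, hl => by
    rw [desc_succ, map_mul, Equiv.Perm.mul_apply, hπ (m - l) (by omega) (by omega),
      show m - (l + 1) = m - l - 1 by omega, Equiv.swap_apply_left,
      perm_desc_apply hπ hm l (by omega)]

theorem perm_desc_apply_of_lt (hπ : ∀ i, 1 ≤ i → i < n → π (s i) = Equiv.swap (i - 1) i)
    {m a : ℕ} (hm : m < n) : ∀ l, a + l < m → π (desc s m l) a = a
  | 0, _ => by simp
  | l + 1, hl => by
    rw [desc_succ, map_mul, Equiv.Perm.mul_apply, hπ (m - l) (by omega) (by omega),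
      Equiv.swap_apply_of_ne_of_ne (by omega) (by omega),
      perm_desc_apply_of_lt hπ hm l (by omega)]

theorem perm_desc_apply_of_gt (hπ : ∀ i, 1 ≤ i → i < n → π (s i) = Equiv.swap (i - 1) i)
    {m a : ℕ} (hm : m < n) (ha : m < a) : ∀ l ≤ m, π (desc s m l) a = a
  | 0, _ => by simp
  | l + 1, hl => by
    rw [desc_succ, map_mul, Equiv.Perm.mul_apply, hπ (m - l) (by omega) (by omega),
      Equiv.swap_apply_of_ne_of_ne (by omega) (by omega),
      perm_desc_apply_of_gt hπ hm ha l (by omega)]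

theorem perm_desc_apply_of_mem (hπ : ∀ i, 1 ≤ i → i < n → π (s i) = Equiv.swap (i - 1) i)
    {m a : ℕ} (hm : m < n) (ha : a ≤ m) : ∀ l ≤ m, m < a + l → π (desc s m l) a = a - 1
  | 0, _, hl => by omega
  | l + 1, hl, h => by
    rw [desc_succ, map_mul, Equiv.Perm.mul_apply, hπ (m - l) (by omega) (by omega)]
    rcases Nat.lt_or_ge m (a + l) with h' | h'
    · rw [Equiv.swap_apply_of_ne_of_ne (by omega) (by omega),
        perm_desc_apply_of_mem hπ hm ha l (by omega) h']
    · have e : m - l = a := by omega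
      rw [e, Equiv.swap_apply_right, perm_desc_apply_of_lt hπ hm l (by omega)]

/-- The Coxeter presentation of the symmetric group: a group generated by such a family, in
which `s i` acts as a transposition, acts faithfully. -/
theorem IsCoxeterFamily.eq_one (hs : IsCoxeterFamily s n)
    (hπ : ∀ i, 1 ≤ i → i < n → π (s i) = Equiv.swap (i - 1) i) :
    ∀ m ≤ n, ∀ x ∈ Subgroup.closure {g | ∃ i, 1 ≤ i ∧ i < m ∧ g = s i}, π x = 1 → x = 1 := by
  intro m
  induction m with
  | zero =>
    intro _ x hx _
    have : {g | ∃ i, 1 ≤ i ∧ i < 0 ∧ g = s i} = ∅ := by ext; simp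
    rw [this] at hx
    simpa using hx
  | succ m ih =>
    intro hm x hx h1
    obtain ⟨y, hy, l, hl, rfl⟩ := hs.exists_desc (by omega) hx
    -- The factor `y` only moves strings below `m`, while `desc s m l` takes `m - l` to `m`. A
    -- trivial product therefore has `l = 0`, and the induction hypothesis applies to `y`.
    have hfix : π y m = m := by
      clear h1 hx
      induction hy using Subgroup.closure_induction with
      | mem g hg =>
        obtain ⟨i, hi, him, rfl⟩ := hg
        rw [hπ i hi (by omega), Equiv.swap_apply_of_ne_of_ne (by omega) (by omega)]
      | one => simp
      | mul a b _ _ ha hb => simp [ha, hb]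
      | inv a _ ha => rw [map_inv, Equiv.Perm.inv_eq_iff_eq, ha]
    have h2 := perm_desc_apply hπ (show m < n by omega) l hl
    have h3 : π (y * desc s m l) (m - l) = m := by simp [h2, hfix]
    rw [h1] at h3
    have h4 : l = 0 := by
      simp at h3
      omega
    subst h4
    rw [desc_zero, mul_one] at h1 ⊢
    exact ih (by omega) y hy h1

end Desc
/-! ### Relations in `B_n / [P_n, P_n]` -/

section Relations
variable {n : ℕ}

theorem crystPerm_sig {i : ℕ} (h : 1 ≤ i ∧ i < n) :
    crystPerm n (sig n i) = adjSwap n ⟨i - 1, by omega⟩ := by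
  rw [sig, dif_pos h]
  exact PresentedGroup.toGroup.of (adjSwap_rels n)

/-- The action of `B_n / [P_n, P_n]` on the strings, numbered from `0` and extended by the
identity to all natural numbers. -/
noncomputable def permN (n : ℕ) : CrystBraid n →* Equiv.Perm ℕ :=
  (Equiv.Perm.viaEmbeddingHom Fin.valEmbedding).comp (crystPerm n)

theorem permN_val (x : CrystBraid n) (a : Fin n) : permN n x a = (crystPerm n x a : ℕ) :=
  Equiv.Perm.viaEmbedding_apply _ _ a

theorem permN_of_ge (x : CrystBraid n) {a : ℕ} (h : n ≤ a) : permN n x a = a := by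
  refine Equiv.Perm.viaEmbedding_apply_of_notMem _ _ a ?_
  rintro ⟨b, rfl⟩
  exact absurd b.2 (not_lt.2 h)

theorem permN_eq_iff {x : CrystBraid n} {y : CrystBraid n} :
    permN n x = permN n y ↔ crystPerm n x = crystPerm n y :=
  (Equiv.Perm.viaEmbeddingHom_injective Fin.valEmbedding).eq_iff

theorem permN_eq_one_iff {x : CrystBraid n} : permN n x = 1 ↔ crystPerm n x = 1 := by
  rw [← map_one (permN n), permN_eq_iff, map_one]

theorem permN_sig {i : ℕ} (h1 : 1 ≤ i) (h2 : i < n) :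
    permN n (sig n i) = Equiv.swap (i - 1) i := by
  ext a
  by_cases ha : a < n
  · have := permN_val (sig n i) ⟨a, ha⟩
    simp only at this
    rw [this, crystPerm_sig ⟨h1, h2⟩, adjSwap]
    simp only [Equiv.swap_apply_def, Fin.ext_iff]
    split_ifs <;> simp_all
  · rw [permN_of_ge _ (by omega), Equiv.swap_apply_of_ne_of_ne (by omega) (by omega)]

theorem sig_comm (i j : ℕ) (h : i + 2 ≤ j) : sig n i * sig n j = sig n j * sig n i := by
  unfold sig
  split_ifs with h1 h2
  · rw [← QuotientGroup.mk_mul, ← QuotientGroup.mk_mul]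
    congr 1
    refine PresentedGroup.mk_eq_mk_of_mul_inv_mem (Or.inl ⟨_, _, ?_, rfl⟩)
    simp only
    omega
  all_goals simp

theorem sig_braid (i : ℕ) (h1 : 1 ≤ i) (h2 : i + 1 < n) :
    sig n (i + 1) * sig n i * sig n (i + 1) = sig n i * sig n (i + 1) * sig n i := by
  unfold sig
  rw [dif_pos ⟨by omega, by omega⟩, dif_pos ⟨by omega, by omega⟩]
  simp only [← QuotientGroup.mk_mul]
  congr 1
  refine PresentedGroup.mk_eq_mk_of_mul_inv_mem (Or.inr ⟨⟨i - 1, by omega⟩, ⟨i, by omega⟩, ?_, rfl⟩)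
  simp only
  omega

theorem closure_sig : Subgroup.closure {g | ∃ i, 1 ≤ i ∧ i < n ∧ g = sig n i} = ⊤ := by
  rw [eq_top_iff]
  rintro x -
  induction x using QuotientGroup.induction_on with
  | H x =>
  have h : x ∈ Subgroup.comap (QuotientGroup.mk' ⁅pureBraid n, pureBraid n⁆)
      (Subgroup.closure {g | ∃ i, 1 ≤ i ∧ i < n ∧ g = sig n i}) := by
    refine PresentedGroup.generated_by _ _ (fun j => ?_) x
    refine Subgroup.subset_closure ⟨j.1 + 1, by omega, by omega, ?_⟩
    rw [sig, dif_pos ⟨by omega, by omega⟩]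
    rfl
  exact h

theorem commute_of_permN {a b : CrystBraid n} (ha : permN n a = 1) (hb : permN n b = 1) :
    Commute a b :=
  ker_crystPerm_comm (permN_eq_one_iff.1 ha) (permN_eq_one_iff.1 hb)

theorem permN_sig_sq (i : ℕ) : permN n (sig n i * sig n i) = 1 := by
  by_cases h : 1 ≤ i ∧ i < n
  · rw [map_mul, permN_sig h.1 h.2, Equiv.swap_mul_self]
  · rw [sig, dif_neg h]
    simp

theorem pureGen_eq (i j : ℕ) : pureGen n i j =
    desc (sig n) (j - 1) (j - 1 - i) * sig n i ^ 2 * (desc (sig n) (j - 1) (j - 1 - i))⁻¹ := rfl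

theorem pureGen_self_succ (i : ℕ) : pureGen n i (i + 1) = sig n i * sig n i := by
  simp [pureGen_eq, sq]

theorem semiconjBy_pureGen_succ {i j : ℕ} (h : i < j) :
    SemiconjBy (sig n j) (pureGen n i j) (pureGen n i (j + 1)) := by
  obtain ⟨j, rfl⟩ : ∃ k, j = k + 1 := ⟨j - 1, by omega⟩
  have e : j + 1 + 1 - 1 - i = j - i + 1 := by omega
  rw [SemiconjBy, pureGen_eq, pureGen_eq, e, Nat.add_sub_cancel, Nat.add_sub_cancel, desc_succ']
  simp [mul_assoc]

theorem permN_pureGen (i j : ℕ) : permN n (pureGen n i j) = 1 := by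
  rw [pureGen_eq, sq, map_mul, map_mul, permN_sig_sq, mul_one, map_inv, mul_inv_cancel]

/-- With conjugations drawn as arrows, this is the fourth side of a commuting square. It transports
conjugation formulas along the braid relations. -/
theorem _root_.SemiconjBy.of_mul_eq {G : Type*} [Group G] {a b c d x y z w : G}
    (ha : SemiconjBy a x y) (hb : SemiconjBy b y z) (hc : SemiconjBy c x w)
    (h : b * a = d * c) : SemiconjBy d w z := by
  have h1 : SemiconjBy (d * c) x z := h ▸ hb.mul_left ha
  have h2 : c * x * c⁻¹ = w := by rw [hc.eq, mul_inv_cancel_right]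
  rw [SemiconjBy, ← h2, ← mul_assoc, ← mul_assoc, h1.eq, mul_assoc, mul_assoc,
    mul_inv_cancel, mul_one]

/-- The square of σ_k is pure and pure elements commute here, so conjugation by σ_k is an involution
on pure elements. -/
theorem semiconjBy_sig_symm {k : ℕ} {x y : CrystBraid n} (hx : permN n x = 1)
    (h : SemiconjBy (sig n k) x y) : SemiconjBy (sig n k) y x := by
  have hc : Commute (sig n k * sig n k) x := commute_of_permN (permN_sig_sq k) hx
  exact SemiconjBy.of_mul_eq (SemiconjBy.one_left x) hc h (mul_one _)

theorem semiconjBy_sig_symm_inv {k : ℕ} {x y : CrystBraid n} (hx : permN n x = 1)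
    (h : SemiconjBy (sig n k) x y) : SemiconjBy (sig n k)⁻¹ x y :=
  SemiconjBy.inv_symm_left (semiconjBy_sig_symm hx h)

theorem commute_sig_pureGen {i k : ℕ} : ∀ j, i < j → (j < k ∨ k + 1 < i) →
    Commute (sig n k) (pureGen n i j) := by
  intro j hj
  induction j, hj using Nat.le_induction with
  | base =>
    intro h
    rw [pureGen_self_succ]
    have : Commute (sig n k) (sig n i) := by
      rcases h with h | h
      · exact (sig_comm i k (by omega)).symm
      · exact sig_comm k i (by omega)
    exact this.mul_right this
  | succ j hj ih =>
    intro h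
    have h1 := semiconjBy_pureGen_succ (n := n) (show i < j by omega)
    refine SemiconjBy.of_mul_eq (ih (by omega)) h1 h1 ?_
    rcases h with h | h
    · exact sig_comm j k (by omega)
    · exact (sig_comm k j (by omega)).symm

theorem commute_sig_pureGen_of_mem {i k : ℕ} (hi : 1 ≤ i) (hik : i < k) : ∀ j, k + 2 ≤ j → j ≤ n →
    Commute (sig n k) (pureGen n i j) := by
  intro j hj
  induction j, hj using Nat.le_induction with
  | base =>
    intro h
    have h1 := (semiconjBy_pureGen_succ (n := n) (show i < k + 1 by omega)).mul_left
      (semiconjBy_pureGen_succ (n := n) hik)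
    -- Conjugation by σ_{k+1} σ_k takes A_{i,k} to A_{i,k+2} and, by the braid relation, σ_{k+1} to
    -- σ_k; it carries one commutation to the other.
    refine SemiconjBy.of_mul_eq (commute_sig_pureGen (k := k + 1) k hik (by omega)) h1 h1 ?_
    rw [sig_braid k (by omega) (by omega), mul_assoc]
  | succ j hj ih =>
    intro h
    have h1 := semiconjBy_pureGen_succ (n := n) (show i < j by omega)
    exact SemiconjBy.of_mul_eq (ih (by omega)) h1 h1 (sig_comm k j (by omega)).symm

theorem semiconjBy_sig_pureGen_left {k : ℕ} (hk : 1 ≤ k) : ∀ j, k + 2 ≤ j → j ≤ n →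
    SemiconjBy (sig n k) (pureGen n (k + 1) j) (pureGen n k j) := by
  intro j hj
  induction j, hj using Nat.le_induction with
  | base =>
    intro h
    have h1 : SemiconjBy (sig n (k + 1) * sig n k) (sig n (k + 1)) (sig n k) := by
      rw [SemiconjBy, sig_braid k hk (by omega), mul_assoc]
    have h2 := (semiconjBy_pureGen_succ (n := n) (show k < k + 1 by omega))
    rw [pureGen_self_succ] at h2
    have h3 := h2.mul_left (h1.mul_right h1)
    rw [pureGen_self_succ]
    -- By the braid relation, conjugating σ_{k+1}² by σ_{k+1}² σ_k yields A_{k,k+2}. The outer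
    -- σ_{k+1}² commutes with the pure element `y` and can be dropped, so A_{k,k+2} = `y`.
    set y := sig n k * (sig n (k + 1) * sig n (k + 1)) * (sig n k)⁻¹ with hy
    have h4 : SemiconjBy (sig n k) (sig n (k + 1) * sig n (k + 1)) y := by
      rw [SemiconjBy, hy, inv_mul_cancel_right]
    have hy1 : permN n y = 1 := by
      rw [hy, map_mul, map_mul, permN_sig_sq, mul_one, map_inv, mul_inv_cancel]
    have h5 : Commute (sig n (k + 1) * sig n (k + 1)) y := commute_of_permN (permN_sig_sq _) hy1
    have h6 := SemiconjBy.of_mul_eq (d := (1 : CrystBraid n)) h4 h5 h3 (by simp [mul_assoc])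
    rw [SemiconjBy, one_mul, mul_one] at h6
    rwa [h6]
  | succ j hj ih =>
    intro h
    exact SemiconjBy.of_mul_eq (ih (by omega)) (semiconjBy_pureGen_succ (by omega))
      (semiconjBy_pureGen_succ (by omega)) (sig_comm k j (by omega)).symm

/-- Conjugation by `σ_k` permutes the `A_{i,j}`. -/
theorem exists_semiconjBy_sig_pureGen {i j k : ℕ} (hi : 1 ≤ i) (hij : i < j) (hj : j ≤ n)
    (hk : 1 ≤ k) (hkn : k < n) : ∃ i' j', 1 ≤ i' ∧ i' < j' ∧ j' ≤ n ∧
      SemiconjBy (sig n k) (pureGen n i j) (pureGen n i' j') := by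
  rcases lt_trichotomy k j with h | rfl | h
  · rcases lt_trichotomy k i with h' | rfl | h'
    · rcases Nat.lt_or_ge (k + 1) i with h2 | h2
      · exact ⟨i, j, hi, hij, hj, commute_sig_pureGen j hij (Or.inr h2)⟩
      · obtain rfl : i = k + 1 := by omega
        exact ⟨k, j, hk, h, hj, semiconjBy_sig_pureGen_left hk j (by omega) hj⟩
    · rcases Nat.lt_or_ge (k + 1) j with h2 | h2
      · exact ⟨k + 1, j, by omega, h2, hj, semiconjBy_sig_symm (permN_pureGen _ _)
          (semiconjBy_sig_pureGen_left hk j (by omega) hj)⟩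
      · obtain rfl : j = k + 1 := by omega
        refine ⟨k, k + 1, hk, by omega, hj, ?_⟩
        rw [pureGen_self_succ]
        exact (Commute.refl _).mul_right (Commute.refl _)
    · rcases Nat.lt_or_ge (k + 1) j with h2 | h2
      · exact ⟨i, j, hi, hij, hj, commute_sig_pureGen_of_mem hi h' j (by omega) hj⟩
      · obtain rfl : j = k + 1 := by omega
        exact ⟨i, k, hi, h', by omega, semiconjBy_sig_symm (permN_pureGen _ _)
          (semiconjBy_pureGen_succ h')⟩
  · exact ⟨i, k + 1, hi, by omega, by omega, semiconjBy_pureGen_succ hij⟩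
  · exact ⟨i, j, hi, hij, hj, commute_sig_pureGen j hij (Or.inl h)⟩

variable (n) in
/-- The subgroup generated by the `A_{i,j}`. -/
def pureGenSubgroup : Subgroup (CrystBraid n) :=
  Subgroup.closure {x | ∃ i j, 1 ≤ i ∧ i < j ∧ j ≤ n ∧ x = pureGen n i j}

theorem permN_of_mem_pureGenSubgroup {x : CrystBraid n} (hx : x ∈ pureGenSubgroup n) :
    permN n x = 1 := by
  refine (Subgroup.closure_le (permN n).ker).2 ?_ hx
  rintro _ ⟨i, j, -, -, -, rfl⟩
  exact permN_pureGen i j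

theorem conj_mem_pureGenSubgroup {g : CrystBraid n}
    (h : ∀ i j, 1 ≤ i → i < j → j ≤ n → g * pureGen n i j * g⁻¹ ∈ pureGenSubgroup n)
    {x : CrystBraid n} (hx : x ∈ pureGenSubgroup n) : g * x * g⁻¹ ∈ pureGenSubgroup n := by
  have : pureGenSubgroup n ≤ (pureGenSubgroup n).comap (MulAut.conj g).toMonoidHom := by
    refine (Subgroup.closure_le _).2 ?_
    rintro _ ⟨i, j, hi, hij, hj, rfl⟩
    exact h i j hi hij hj
  exact this hx

instance pureGenSubgroup_normal : (pureGenSubgroup n).Normal := by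
  constructor
  intro x hx g
  have hg : g ∈ Subgroup.closure {g | ∃ i, 1 ≤ i ∧ i < n ∧ g = sig n i} := by
    rw [closure_sig]; trivial
  induction hg using Subgroup.closure_induction'' generalizing x with
  | mem g hg =>
    obtain ⟨k, hk, hkn, rfl⟩ := hg
    refine conj_mem_pureGenSubgroup (fun i j hi hij hj => ?_) hx
    obtain ⟨i', j', hi', hij', hj', h⟩ := exists_semiconjBy_sig_pureGen hi hij hj hk hkn
    rw [h.eq, mul_inv_cancel_right]
    exact Subgroup.subset_closure ⟨i', j', hi', hij', hj', rfl⟩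
  | inv_mem g hg =>
    obtain ⟨k, hk, hkn, rfl⟩ := hg
    refine conj_mem_pureGenSubgroup (fun i j hi hij hj => ?_) hx
    obtain ⟨i', j', hi', hij', hj', h⟩ := exists_semiconjBy_sig_pureGen hi hij hj hk hkn
    rw [(semiconjBy_sig_symm_inv (permN_pureGen _ _) h).eq, mul_inv_cancel_right]
    exact Subgroup.subset_closure ⟨i', j', hi', hij', hj', rfl⟩
  | one => simpa using hx
  | mul a b _ _ iha ihb =>
    have := iha _ (ihb x hx)
    simpa [mul_assoc] using this

/-- The `A_{i,j}` generate the kernel of the action on the strings. -/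
theorem mem_pureGenSubgroup {x : CrystBraid n} (hx : permN n x = 1) : x ∈ pureGenSubgroup n := by
  let q := QuotientGroup.mk' (pureGenSubgroup n)
  let π : CrystBraid n ⧸ pureGenSubgroup n →* Equiv.Perm ℕ :=
    QuotientGroup.lift _ (permN n) fun _ h => permN_of_mem_pureGenSubgroup h
  -- Modulo the A_{i,j} the squares σ_i² = A_{i,i+1} vanish, so the quotient is generated by a
  -- Coxeter family and acts faithfully on the strings.
  have hs : IsCoxeterFamily (fun i => q (sig n i)) n :=
    { comm := fun i j _ hij _ => by rw [← map_mul, sig_comm i j hij, map_mul]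
      braid := fun i h1 h2 => by simp only [← map_mul]; rw [sig_braid i h1 h2]
      sq := fun i h1 h2 => by
        rw [← map_mul, ← pureGen_self_succ, QuotientGroup.mk'_apply, QuotientGroup.eq_one_iff]
        exact Subgroup.subset_closure ⟨i, i + 1, h1, by omega, by omega, rfl⟩ }
  have hx' : q x ∈ Subgroup.closure {g | ∃ i, 1 ≤ i ∧ i < n ∧ g = q (sig n i)} := by
    have h1 : x ∈ Subgroup.closure {g | ∃ i, 1 ≤ i ∧ i < n ∧ g = sig n i} := by
      rw [closure_sig]; trivial
    have h2 := Subgroup.mem_map_of_mem q h1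
    rw [MonoidHom.map_closure] at h2
    refine Subgroup.closure_mono ?_ h2
    rintro _ ⟨_, ⟨i, hi, hin, rfl⟩, rfl⟩
    exact ⟨i, hi, hin, rfl⟩
  have := hs.eq_one (π := π) (fun i h1 h2 => permN_sig h1 h2) n le_rfl _ hx' hx
  rwa [QuotientGroup.mk'_apply, QuotientGroup.eq_one_iff] at this

end Relations

/-! ### Winding numbers -/

/-- The free abelian group on unordered pairs of strings. -/
abbrev PairLattice : Type := Sym2 ℕ →₀ ℤ

/-- The basis vector of the pair `{a, b}`. -/
noncomputable def pairVec (a b : ℕ) : PairLattice := Finsupp.single s(a, b) 1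

theorem pairVec_comm (a b : ℕ) : pairVec a b = pairVec b a := by rw [pairVec, Sym2.eq_swap, pairVec]

/-- A permutation of the strings acts on pairs. -/
noncomputable def pairAct (w : Equiv.Perm ℕ) : PairLattice →+ PairLattice :=
  Finsupp.mapDomain.addMonoidHom (Sym2.map w)

@[simp] theorem pairAct_single (w : Equiv.Perm ℕ) (z : Sym2 ℕ) (c : ℤ) :
    pairAct w (Finsupp.single z c) = Finsupp.single (z.map w) c := Finsupp.mapDomain_single

@[simp] theorem pairAct_pairVec (w : Equiv.Perm ℕ) (a b : ℕ) :
    pairAct w (pairVec a b) = pairVec (w a) (w b) := by simp [pairVec]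

@[simp] theorem pairAct_one (v : PairLattice) : pairAct 1 v = v := by
  have : (Sym2.map ((1 : Equiv.Perm ℕ) : ℕ → ℕ)) = id := by
    rw [Equiv.Perm.coe_one, Sym2.map_id]
  rw [pairAct, Finsupp.mapDomain.addMonoidHom_apply, this, Finsupp.mapDomain_id]

theorem pairAct_mul (w w' : Equiv.Perm ℕ) (v : PairLattice) :
    pairAct (w * w') v = pairAct w (pairAct w' v) := by
  have : Sym2.map ((w * w' : Equiv.Perm ℕ) : ℕ → ℕ) = Sym2.map w ∘ Sym2.map w' := by
    rw [Equiv.Perm.coe_mul, Sym2.map_comp]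
  simp only [pairAct, Finsupp.mapDomain.addMonoidHom_apply, this, Finsupp.mapDomain_comp]

/-- The action of permutations on pairs, as automorphisms of a multiplicative group. -/
noncomputable def pairAut : Equiv.Perm ℕ →* MulAut (Multiplicative PairLattice) where
  toFun w :=
    { toFun := fun v => Multiplicative.ofAdd (pairAct w v.toAdd)
      invFun := fun v => Multiplicative.ofAdd (pairAct w⁻¹ v.toAdd)
      left_inv := fun v => by simp [← pairAct_mul]
      right_inv := fun v => by simp [← pairAct_mul]
      map_mul' := fun v v' => by simp }
  map_one' := by ext v : 1; simp
  map_mul' w w' := by ext v : 1; simp [pairAct_mul]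

theorem pairAut_apply (w : Equiv.Perm ℕ) (v : Multiplicative PairLattice) :
    pairAut w v = Multiplicative.ofAdd (pairAct w v.toAdd) := rfl

section Winding
variable {n : ℕ}

/-- The image of a generator in the semidirect product. -/
noncomputable def windGen (n : ℕ) (i : Fin (n - 1)) :
    Multiplicative PairLattice ⋊[pairAut] Equiv.Perm ℕ :=
  ⟨Multiplicative.ofAdd (pairVec i (i + 1)), Equiv.swap (i : ℕ) (i + 1)⟩

/-- Both sides of the braid relation make each pair among the three strings cross exactly once;
generators far apart fix each other's pair. -/
theorem windGen_rels (n : ℕ) : ∀ w ∈ braidRels n, FreeGroup.lift (windGen n) w = 1 := by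
  rintro w (⟨i, j, hij, rfl⟩ | ⟨i, j, hij, rfl⟩)
  · simp only [map_mul, map_inv, FreeGroup.lift_apply_of]
    rw [mul_inv_eq_one]
    ext : 1
    · simp only [windGen, SemidirectProduct.mul_left, pairAut_apply, toAdd_ofAdd, pairAct_pairVec]
      rw [Equiv.swap_apply_of_ne_of_ne (by omega) (by omega),
        Equiv.swap_apply_of_ne_of_ne (by omega) (by omega),
        Equiv.swap_apply_of_ne_of_ne (by omega) (by omega),
        Equiv.swap_apply_of_ne_of_ne (by omega) (by omega), mul_comm]
    · simp only [windGen, SemidirectProduct.mul_right]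
      refine (Equiv.Perm.Disjoint.commute fun x => ?_).eq
      by_cases hx : x = i ∨ x = i + 1
      · right
        exact Equiv.swap_apply_of_ne_of_ne (by omega) (by omega)
      · left
        exact Equiv.swap_apply_of_ne_of_ne (by omega) (by omega)
  · simp only [map_mul, map_inv, FreeGroup.lift_apply_of]
    rw [mul_inv_eq_one]
    ext : 1
    · simp only [windGen, SemidirectProduct.mul_left, SemidirectProduct.mul_right, pairAut_apply,
        toAdd_ofAdd, pairAct_pairVec, hij, Equiv.Perm.mul_apply, ← ofAdd_add]
      congr 1
      have h1 : Equiv.swap (i : ℕ) (i + 1) (i + 1 + 1) = i + 1 + 1 :=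
        Equiv.swap_apply_of_ne_of_ne (by omega) (by omega)
      have h2 : Equiv.swap (i + 1 : ℕ) (i + 1 + 1) i = i :=
        Equiv.swap_apply_of_ne_of_ne (by omega) (by omega)
      simp only [h1, h2, Equiv.swap_apply_left, Equiv.swap_apply_right]
      abel
    · simp only [windGen, SemidirectProduct.mul_right, hij]
      have h1 : (i : ℕ) ≠ i + 1 := by omega
      have h2 : (i : ℕ) ≠ i + 1 + 1 := by omega
      have h3 : (i + 1 : ℕ) ≠ i + 1 + 1 := by omega
      rw [Equiv.swap_mul_swap_mul_swap h1 h2, Equiv.swap_comm (i : ℕ) (i + 1),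
        Equiv.swap_comm (i + 1 : ℕ) (i + 1 + 1), Equiv.swap_mul_swap_mul_swap h3.symm h2.symm,
        Equiv.swap_comm]

/-- The homomorphism from `B_n` recording winding numbers and the permutation. -/
noncomputable def braidWind (n : ℕ) :
    BraidGroup n →* Multiplicative PairLattice ⋊[pairAut] Equiv.Perm ℕ :=
  PresentedGroup.toGroup (windGen_rels n)

theorem braidWind_right (x : BraidGroup n) :
    (braidWind n x).right = permN n (QuotientGroup.mk x) := by
  have : SemidirectProduct.rightHom.comp (braidWind n) =
      (permN n).comp (QuotientGroup.mk' ⁅pureBraid n, pureBraid n⁆) := by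
    refine PresentedGroup.ext fun i => ?_
    have h1 : braidWind n (PresentedGroup.of i) = windGen n i := PresentedGroup.toGroup.of _
    have h2 := permN_sig (n := n) (i := i + 1) (by omega) (by omega)
    rw [sig, dif_pos ⟨by omega, by omega⟩] at h2
    simp only [MonoidHom.comp_apply, h1]
    exact h2.symm
  exact DFunLike.congr_fun this x

/-- The homomorphism from `B_n / [P_n, P_n]` recording winding numbers and the permutation. -/
noncomputable def crystWind (n : ℕ) :
    CrystBraid n →* Multiplicative PairLattice ⋊[pairAut] Equiv.Perm ℕ :=
  QuotientGroup.lift _ (braidWind n) (by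
    -- Pure braids land in the pair lattice, which is abelian, so their commutators die.
    have key : ⁅pureBraid n, pureBraid n⁆ ≤ (braidWind n).ker := by
      rw [Subgroup.commutator_le]
      intro x hx y hy
      rw [MonoidHom.mem_ker, map_commutatorElement, commutatorElement_eq_one_iff_mul_comm]
      have hx' : (braidWind n x).right = 1 := by
        rw [braidWind_right, permN_eq_one_iff]; exact hx
      have hy' : (braidWind n y).right = 1 := by
        rw [braidWind_right, permN_eq_one_iff]; exact hy
      ext : 1
      · simp [SemidirectProduct.mul_left, hx', hy', mul_comm]
      · simp [hx', hy']
    exact fun x hx => key hx)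

theorem crystWind_right (x : CrystBraid n) : (crystWind n x).right = permN n x := by
  induction x using QuotientGroup.induction_on with
  | H x => exact braidWind_right x

/-- The total winding numbers of the pairs of strings. -/
noncomputable def wind (x : CrystBraid n) : PairLattice := (crystWind n x).left.toAdd

theorem wind_mul (x y : CrystBraid n) :
    wind (x * y) = wind x + pairAct (permN n x) (wind y) := by
  rw [wind, map_mul, SemidirectProduct.mul_left, crystWind_right]
  rfl

@[simp] theorem wind_one : wind (1 : CrystBraid n) = 0 := by
  rw [wind, map_one]
  rfl

theorem wind_inv (x : CrystBraid n) :
    wind x⁻¹ = -pairAct (permN n x)⁻¹ (wind x) := by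
  have h := wind_mul x⁻¹ x
  rw [inv_mul_cancel, wind_one, map_inv] at h
  exact eq_neg_of_add_eq_zero_left h.symm

theorem wind_conj (g x : CrystBraid n) (hx : permN n x = 1) :
    wind (g * x * g⁻¹) = pairAct (permN n g) (wind x) := by
  rw [wind_mul, wind_mul, map_mul, hx, mul_one, wind_inv, map_neg, ← pairAct_mul,
    mul_inv_cancel, pairAct_one]
  abel

theorem wind_pow (x : CrystBraid n) (k : ℕ) :
    wind (x ^ k) = ∑ i ∈ Finset.range k, pairAct (permN n x ^ i) (wind x) := by
  induction k with
  | zero => simp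
  | succ k ih => rw [pow_succ, wind_mul, ih, Finset.sum_range_succ, map_pow]

theorem wind_sig {i : ℕ} (h1 : 1 ≤ i) (h2 : i < n) : wind (sig n i) = pairVec (i - 1) i := by
  have h : crystWind n (sig n i) = windGen n ⟨i - 1, by omega⟩ := by
    rw [sig, dif_pos ⟨h1, h2⟩]
    exact PresentedGroup.toGroup.of (windGen_rels n)
  rw [wind, h]
  simp only [windGen, toAdd_ofAdd]
  rw [Nat.sub_add_cancel h1]

theorem wind_pureGen {i j : ℕ} (hi : 1 ≤ i) (hij : i < j) (hj : j ≤ n) :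
    wind (pureGen n i j) = (2 : ℤ) • pairVec (i - 1) (j - 1) := by
  have hπ : ∀ i, 1 ≤ i → i < n → permN n (sig n i) = Equiv.swap (i - 1) i :=
    fun i h1 h2 => permN_sig h1 h2
  rw [pureGen_eq, sq, wind_conj _ _ (permN_sig_sq i), wind_mul, wind_sig hi (by omega),
    permN_sig hi (by omega), pairAct_pairVec, Equiv.swap_apply_left, Equiv.swap_apply_right,
    pairVec_comm i (i - 1), ← two_smul ℤ, map_zsmul, pairAct_pairVec]
  have h1 := perm_desc_apply hπ (m := j - 1) (by omega) (j - 1 - i) (by omega)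
  rw [show j - 1 - (j - 1 - i) = i by omega] at h1
  rw [h1, perm_desc_apply_of_lt hπ (by omega) _ (by omega)]

theorem wind_add_of_permN {x : CrystBraid n} (hx : permN n x = 1) (y : CrystBraid n) :
    wind (x * y) = wind x + wind y := by rw [wind_mul, hx, pairAct_one]

variable (n) in
/-- Winding numbers of pure elements, as a homomorphism. -/
noncomputable def windHom : (permN n).ker →* Multiplicative PairLattice where
  toFun x := Multiplicative.ofAdd (wind (x : CrystBraid n))
  map_one' := by simp
  map_mul' x y := by simp [wind_add_of_permN x.2]

theorem wind_zpow_of_permN {x : CrystBraid n} (hx : permN n x = 1) (k : ℤ) :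
    wind (x ^ k) = k • wind x :=
  congrArg Multiplicative.toAdd (map_zpow (windHom n) (⟨x, hx⟩ : (permN n).ker) k)

theorem wind_pow_of_permN {x : CrystBraid n} (hx : permN n x = 1) (k : ℕ) :
    wind (x ^ k) = (k : ℤ) • wind x := by
  rw [← wind_zpow_of_permN hx, zpow_natCast]

/-- A pure element without winding is trivial. -/
theorem eq_one_of_wind {x : CrystBraid n} (hx : permN n x = 1) (hw : wind x = 0) : x = 1 := by
  classical
  let : CommGroup (permN n).ker :=
    { (inferInstance : Group (permN n).ker) with
      mul_comm := fun a b => Subtype.ext (commute_of_permN a.2 b.2) }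
  -- `T` sends a pair to the corresponding A_{i,j}, with `inf` and `sup` putting the indices in
  -- order; its values on diagonal or out-of-range pairs play no role. Each pure element is `T v`
  -- for some `v` with winding `2 v`, so vanishing winding forces `v = 0`.
  let T : (Sym2 ℕ →₀ ℤ) →+ Additive (permN n).ker :=
    Finsupp.liftAddHom fun z => zmultiplesHom _ (Additive.ofMul
      (⟨pureGen n (z.inf + 1) (z.sup + 1), permN_pureGen _ _⟩ : (permN n).ker))
  have hT : ∀ i j, 1 ≤ i → i < j → j ≤ n → T (pairVec (i - 1) (j - 1)) =
      Additive.ofMul (⟨pureGen n i j, permN_pureGen _ _⟩ : (permN n).ker) := by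
    intro i j hi hij hj
    simp only [T, pairVec, Finsupp.liftAddHom_apply_single, zmultiplesHom_apply, one_zsmul]
    congr 2
    simp only [Sym2.inf_mk, Sym2.sup_mk]
    rw [min_eq_left (by omega), max_eq_right (by omega), Nat.sub_add_cancel hi,
      Nat.sub_add_cancel (by omega)]
  have hmem : ∀ y ∈ pureGenSubgroup n, ∃ v, wind y = (2 : ℤ) • v ∧
      y = ((T v).toMul : CrystBraid n) := by
    intro y hy
    induction hy using Subgroup.closure_induction with
    | mem y hy =>
      obtain ⟨i, j, hi, hij, hj, rfl⟩ := hy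
      exact ⟨_, wind_pureGen hi hij hj, by rw [hT i j hi hij hj]; rfl⟩
    | one => exact ⟨0, by simp, by rw [map_zero]; rfl⟩
    | mul a b ha hb iha ihb =>
      obtain ⟨v, hv, hv'⟩ := iha
      obtain ⟨w, hw, hw'⟩ := ihb
      refine ⟨v + w, ?_, ?_⟩
      · rw [wind_add_of_permN (permN_of_mem_pureGenSubgroup ha), hv, hw, zsmul_add]
      · rw [map_add, hv', hw']
        rfl
    | inv a ha iha =>
      obtain ⟨v, hv, hv'⟩ := iha
      refine ⟨-v, ?_, ?_⟩
      · rw [wind_inv, permN_of_mem_pureGenSubgroup ha, inv_one, pairAct_one, hv, zsmul_neg]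
      · rw [map_neg, hv']
        rfl
  obtain ⟨v, hv, hv'⟩ := hmem x (mem_pureGenSubgroup hx)
  have h0 : v = 0 := by
    rw [hw] at hv
    exact (smul_eq_zero.1 hv.symm).resolve_left two_ne_zero
  rw [hv', h0, map_zero]
  rfl

/-- Elements of `B_n / [P_n, P_n]` are determined by the permutation and the winding numbers. -/
theorem ext_wind {x y : CrystBraid n} (h : permN n x = permN n y) (hw : wind x = wind y) :
    x = y := by
  rw [← inv_mul_eq_one]
  refine eq_one_of_wind (by simp [h]) ?_
  rw [wind_mul, wind_inv, map_inv, h, hw, neg_add_cancel]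

end Winding
-- Winding numbers of descending products
section DescWind
variable {n : ℕ}

theorem desc_add {G : Type*} [Group G] (s : ℕ → G) (m l k : ℕ) :
    desc s m (l + k) = desc s m l * desc s (m - l) k := by
  induction k with
  | zero => simp
  | succ k ih => rw [← add_assoc, desc_succ, ih, desc_succ, mul_assoc, Nat.sub_sub]

theorem desc_congr {G : Type*} [Group G] {s s' : ℕ → G} {m l : ℕ}
    (h : ∀ k < l, s (m - k) = s' (m - k)) : desc s m l = desc s' m l := by
  rw [desc, desc]
  congr 1
  exact List.map_congr_left fun k hk => h k (List.mem_range.1 hk)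

/-- Only one string passes the others: each new factor adds its crossing with the next lower string,
and the prefix relabels that string as `m`. -/
theorem wind_desc {s : ℕ → CrystBraid n} {ε : ℕ → ℤ}
    (hπ : ∀ i, 1 ≤ i → i < n → permN n (s i) = Equiv.swap (i - 1) i)
    (hw : ∀ i, 1 ≤ i → i < n → wind (s i) = ε i • pairVec (i - 1) i) {m : ℕ} (hm : m < n) :
    ∀ l ≤ m, wind (desc s m l) = ∑ k ∈ Finset.range l, ε (m - k) • pairVec (m - (k + 1)) m
  | 0, _ => by simp
  | l + 1, hl => by
    have h1 : m - l - 1 = m - (l + 1) := by omega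
    rw [desc_succ, wind_mul, wind_desc hπ hw hm l (by omega), Finset.sum_range_succ,
      hw _ (by omega) (by omega), map_zsmul, pairAct_pairVec, h1,
      perm_desc_apply hπ hm l (by omega), perm_desc_apply_of_lt hπ hm l (by omega)]

end DescWind

/-! ### A single block -/

section Block
variable {n : ℕ}

/-- The generator `σ_i` or its inverse, according to the position of `i`. -/
def signedSig (n a i : ℕ) : CrystBraid n := if a < i then sig n i else (sig n i)⁻¹

theorem permN_signedSig (a : ℕ) {i : ℕ} (h1 : 1 ≤ i) (h2 : i < n) :
    permN n (signedSig n a i) = Equiv.swap (i - 1) i := by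
  unfold signedSig
  split_ifs
  · exact permN_sig h1 h2
  · rw [map_inv, permN_sig h1 h2, Equiv.swap_inv]

theorem wind_signedSig (a : ℕ) {i : ℕ} (h1 : 1 ≤ i) (h2 : i < n) :
    wind (signedSig n a i) = (if a < i then 1 else -1 : ℤ) • pairVec (i - 1) i := by
  unfold signedSig
  split_ifs
  · rw [wind_sig h1 h2, one_smul]
  · rw [wind_inv, permN_sig h1 h2, wind_sig h1 h2, Equiv.swap_inv, pairAct_pairVec,
      Equiv.swap_apply_left, Equiv.swap_apply_right, pairVec_comm, neg_one_smul]

/-- Both halves merge into one descending product of signed generators, with the sign changing at `m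
+ h`. The permutation of δ is blind to the signs and only its winding sees them. -/
theorem deltaBlock_eq (m h : ℕ) :
    deltaBlock n m (2 * h + 1) = desc (signedSig n (m + h)) (m + 2 * h) (2 * h) := by
  have e1 : m + (2 * h + 1) - 1 = m + 2 * h := by omega
  have e2 : (2 * h + 1 - 1) / 2 = h := by omega
  have e3 : m + 2 * h - h = m + h := by omega
  rw [two_mul, desc_add, ← two_mul, e3, deltaBlock, e1, e2]
  congr 1
  · refine desc_congr (s := sig n) fun k hk => ?_
    rw [signedSig, if_pos (by omega)]
  · refine desc_congr (s := fun i => (sig n i)⁻¹) fun k hk => ?_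
    rw [signedSig, if_neg (by omega)]

/-- The string at cyclic position `x` of the block of size `z` that starts at `m`. -/
def blockStr (m : ℕ) {z : ℕ} (x : ZMod z) : ℕ := m + x.val

theorem blockStr_natCast (m : ℕ) {z a : ℕ} (h : a < z) : blockStr m (a : ZMod z) = m + a := by
  rw [blockStr, ZMod.val_natCast_of_lt h]

theorem permN_deltaBlock {m z : ℕ} [NeZero z] (hz : Odd z) (hn : m + z ≤ n) (x : ZMod z) :
    permN n (deltaBlock n m z) (blockStr m x) = blockStr m (x - 1) := by
  obtain ⟨h, rfl⟩ := hz
  have hπ : ∀ i, 1 ≤ i → i < n → permN n (signedSig n (m + h) i) = Equiv.swap (i - 1) i :=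
    fun i h1 h2 => permN_signedSig _ h1 h2
  rw [deltaBlock_eq]
  obtain ⟨a, ha, rfl⟩ : ∃ a < 2 * h + 1, x = (a : ZMod (2 * h + 1)) :=
    ⟨x.val, x.val_lt, (ZMod.natCast_zmod_val x).symm⟩
  rw [blockStr_natCast m ha]
  cases a with
  | zero =>
    have h1 := perm_desc_apply hπ (m := m + 2 * h) (by omega) (2 * h) (by omega)
    have h2 : ((0 : ℕ) : ZMod (2 * h + 1)) - 1 = ((2 * h : ℕ) : ZMod (2 * h + 1)) := by
      have := ZMod.natCast_self (2 * h + 1)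
      push_cast at this ⊢
      linear_combination -this
    rw [h2, blockStr_natCast m (by omega)]
    simpa using h1
  | succ a =>
    rw [perm_desc_apply_of_mem hπ (by omega) (by omega) _ (by omega) (by omega)]
    have h2 : ((a + 1 : ℕ) : ZMod (2 * h + 1)) - 1 = (a : ZMod (2 * h + 1)) := by push_cast; ring
    rw [h2, blockStr_natCast m (by omega)]
    omega

theorem permN_deltaBlock_of_notMem {m z a : ℕ} (hz : Odd z) (hn : m + z ≤ n)
    (ha : a < m ∨ m + z ≤ a) : permN n (deltaBlock n m z) a = a := by
  obtain ⟨h, rfl⟩ := hz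
  have hπ : ∀ i, 1 ≤ i → i < n → permN n (signedSig n (m + h) i) = Equiv.swap (i - 1) i :=
    fun i h1 h2 => permN_signedSig _ h1 h2
  rw [deltaBlock_eq]
  rcases ha with ha | ha
  · exact perm_desc_apply_of_lt hπ (by omega) _ (by omega)
  · exact perm_desc_apply_of_gt hπ (by omega) (by omega) _ (by omega)

/-- The sum of all pairs at cyclic distance `d` in a block. -/
noncomputable def orbitSum (m z : ℕ) [NeZero z] (d : ZMod z) : PairLattice :=
  ∑ y : ZMod z, pairVec (blockStr m y) (blockStr m (y + d))

theorem orbitSum_neg (m z : ℕ) [NeZero z] (d : ZMod z) : orbitSum m z (-d) = orbitSum m z d := by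
  rw [orbitSum, ← Equiv.sum_comp (Equiv.addRight d)]
  refine Finset.sum_congr rfl fun y _ => ?_
  rw [pairVec_comm]
  simp

theorem sum_range_natCast {M : Type*} [AddCommMonoid M] (z : ℕ) [NeZero z] (f : ZMod z → M) :
    ∑ i ∈ Finset.range z, f i = ∑ y, f y := by
  refine Finset.sum_nbij' (fun i : ℕ => (i : ZMod z)) (fun y => y.val) ?_ ?_ ?_ ?_ ?_
  · simp
  · simp [ZMod.val_lt]
  · intro a ha
    exact ZMod.val_natCast_of_lt (Finset.mem_range.1 ha)
  · simp
  · simp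

theorem perm_pow_blockStr {w : Equiv.Perm ℕ} {m z : ℕ}
    (hw : ∀ x : ZMod z, w (blockStr m x) = blockStr m (x - 1)) (k : ℕ) (x : ZMod z) :
    (w ^ k) (blockStr m x) = blockStr m (x - (k : ZMod z)) := by
  induction k with
  | zero => simp
  | succ k ih =>
    rw [pow_succ', Equiv.Perm.mul_apply, ih, hw]
    push_cast
    congr 1
    ring

theorem sum_pairAct_pow {w : Equiv.Perm ℕ} {m z : ℕ} [NeZero z]
    (hw : ∀ x : ZMod z, w (blockStr m x) = blockStr m (x - 1)) (x y : ZMod z) :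
    ∑ i ∈ Finset.range z, pairAct (w ^ i) (pairVec (blockStr m x) (blockStr m y)) =
      orbitSum m z (y - x) := by
  simp only [pairAct_pairVec, perm_pow_blockStr hw]
  rw [sum_range_natCast z fun i => pairVec (blockStr m (x - i)) (blockStr m (y - i)), orbitSum,
    ← Equiv.sum_comp (Equiv.subLeft x)]
  refine Finset.sum_congr rfl fun i _ => ?_
  rw [Equiv.subLeft_apply]
  congr 2 <;> ring

theorem wind_deltaBlock {m h : ℕ} (hn : m + (2 * h + 1) ≤ n) :
    wind (deltaBlock n m (2 * h + 1)) = ∑ k ∈ Finset.range (2 * h),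
      (if k < h then 1 else -1 : ℤ) • pairVec (blockStr m ((2 * h - (k + 1) : ℕ) :
        ZMod (2 * h + 1))) (blockStr m ((2 * h : ℕ) : ZMod (2 * h + 1))) := by
  have hπ : ∀ i, 1 ≤ i → i < n → permN n (signedSig n (m + h) i) = Equiv.swap (i - 1) i :=
    fun i h1 h2 => permN_signedSig _ h1 h2
  rw [deltaBlock_eq, wind_desc hπ (fun i h1 h2 => wind_signedSig _ h1 h2) (by omega) _ (by omega)]
  refine Finset.sum_congr rfl fun k hk => ?_
  rw [Finset.mem_range] at hk
  rw [blockStr_natCast m (by omega), blockStr_natCast m (by omega)]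
  congr 2
  · rw [eq_iff_iff]; omega
  · omega

theorem pairAct_wind_deltaBlock {m z : ℕ} (hz : Odd z) (hn : m + z ≤ n) {w : Equiv.Perm ℕ}
    (hw : ∀ x : ZMod z, w (blockStr m x) = blockStr m x) :
    pairAct w (wind (deltaBlock n m z)) = wind (deltaBlock n m z) := by
  obtain ⟨h, rfl⟩ := hz
  simp only [wind_deltaBlock hn, map_sum, map_zsmul, pairAct_pairVec, hw]

/-- In δ, the factor numbered `k` crosses a pair at cyclic distance `k + 1`, positively for `k < h`
and negatively otherwise. The reflection `k ↦ 2 * h - 1 - k` negates both the distance modulo `2 * h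
+ 1` and the sign, while orbit sums of unordered pairs do not change when the distance is negated.
So the total equals its own negative, and the pair lattice has no torsion. -/
theorem sum_pairAct_wind_deltaBlock {w : Equiv.Perm ℕ} {m z : ℕ} [NeZero z] (hz : Odd z)
    (hn : m + z ≤ n) (hw : ∀ x : ZMod z, w (blockStr m x) = blockStr m (x - 1)) :
    ∑ i ∈ Finset.range z, pairAct (w ^ i) (wind (deltaBlock n m z)) = 0 := by
  obtain ⟨h, rfl⟩ := hz
  have h2 : ∑ i ∈ Finset.range (2 * h + 1), pairAct (w ^ i) (wind (deltaBlock n m (2 * h + 1))) =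
      ∑ k ∈ Finset.range (2 * h),
        (if k < h then 1 else -1 : ℤ) • orbitSum m (2 * h + 1) ((k + 1 : ℕ) : ZMod _) := by
    rw [wind_deltaBlock hn]
    simp only [map_sum, map_zsmul]
    rw [Finset.sum_comm]
    refine Finset.sum_congr rfl fun k hk => ?_
    rw [Finset.mem_range] at hk
    rw [← Finset.smul_sum, sum_pairAct_pow hw, Nat.cast_sub (by omega)]
    congr 2
    ring
  rw [h2]
  set S := ∑ k ∈ Finset.range (2 * h),
    (if k < h then 1 else -1 : ℤ) • orbitSum m (2 * h + 1) ((k + 1 : ℕ) : ZMod _) with hS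
  have h3 : S = -S := by
    conv_lhs => rw [hS, ← Finset.sum_range_reflect]
    rw [hS, ← Finset.sum_neg_distrib]
    refine Finset.sum_congr rfl fun k hk => ?_
    rw [Finset.mem_range] at hk
    rw [← neg_smul, ← orbitSum_neg]
    congr 1
    · split_ifs <;> omega
    · congr 1
      have e : 2 * h - 1 - k + 1 = 2 * h - k := by omega
      have := ZMod.natCast_self (2 * h + 1)
      rw [e, Nat.cast_sub (by omega)]
      push_cast at this ⊢
      linear_combination -this
  have h4 : (2 : ℤ) • S = 0 := by rw [two_smul]; nth_rewrite 1 [h3]; exact neg_add_cancel S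
  exact (smul_eq_zero.1 h4).resolve_left two_ne_zero

end Block

/-! ### All blocks -/

section Blocks
variable {t : ℕ} (P : Fin t → ℕ)

theorem offset_add_le {j h : Fin t} (hjh : j < h) : offset P j + P j ≤ offset P h := by
  rw [offset, offset, add_comm, ← Finset.sum_insert (by simp)]
  refine Finset.sum_le_sum_of_subset fun i hi => ?_
  simp only [Finset.mem_insert, Finset.mem_Iio] at hi ⊢
  rcases hi with rfl | hi
  · exact hjh
  · exact hi.trans hjh

theorem offset_add_le_strands (j : Fin t) : offset P j + P j ≤ strands P := by
  rw [offset, strands, add_comm, ← Finset.sum_insert (by simp)]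
  exact Finset.sum_le_sum_of_subset (Finset.subset_univ _)

/-- The string at cyclic position `x` of block `j`. -/
def str (j : Fin t) (x : ZMod (P j)) : ℕ := blockStr (offset P j) x

variable {P}

theorem str_natCast {j : Fin t} {a : ℕ} (h : a < P j) : str P j a = offset P j + a :=
  blockStr_natCast _ h

theorem offset_le_str (j : Fin t) (x : ZMod (P j)) : offset P j ≤ str P j x := Nat.le_add_right _ _

theorem permN_twist_eq (j : Fin t) : permN _ (twist P j) = permN _ (deltaAt P j) := by
  rw [twist, map_mul, permN_pureGen, one_mul]

theorem permN_list_prod {g : Fin t → CrystBraid (strands P)}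
    (hg : ∀ j h (x : ZMod (P h)),
      permN _ (g j) (str P h x) = if h = j then str P h (x - 1) else str P h x)
    (h : Fin t) (x : ZMod (P h)) : ∀ l : List (Fin t), l.Nodup →
    permN _ (l.map g).prod (str P h x) = if h ∈ l then str P h (x - 1) else str P h x
  | [], _ => by simp
  | j :: l, hl => by
    have hl' := List.nodup_cons.1 hl
    rw [List.map_cons, List.prod_cons, map_mul, Equiv.Perm.mul_apply, permN_list_prod hg h x l hl'.2]
    by_cases hh : h = j
    · subst hh
      rw [if_neg hl'.1, hg, if_pos rfl, if_pos (by simp)]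
    · simp only [List.mem_cons, hh, false_or]
      split_ifs
      · rw [hg, if_neg hh]
      · rw [hg, if_neg hh]

theorem wind_twist (h2 : ∀ j, 2 ≤ P j) (j : Fin t) : wind (twist P j) =
    (2 : ℤ) • pairVec (str P j 0) (str P j 1) + wind (deltaAt P j) := by
  have := offset_add_le_strands P j
  have := h2 j
  rw [twist, wind_add_of_permN (permN_pureGen _ _), wind_pureGen (by omega) (by omega) (by omega)]
  have e0 := str_natCast (P := P) (j := j) (a := 0) (by omega)
  have e1 := str_natCast (P := P) (j := j) (a := 1) (by omega)
  rw [Nat.cast_zero] at e0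
  rw [Nat.cast_one] at e1
  rw [e0, e1]
  rfl

theorem permN_prod_ofFn {g : Fin t → CrystBraid (strands P)}
    (hg : ∀ j h (x : ZMod (P h)),
      permN _ (g j) (str P h x) = if h = j then str P h (x - 1) else str P h x)
    (h : Fin t) (x : ZMod (P h)) :
    permN _ (List.ofFn g).prod (str P h x) = str P h (x - 1) := by
  rw [List.ofFn_eq_map, permN_list_prod hg h x _ (List.nodup_finRange t),
    if_pos (List.mem_finRange h)]

theorem pairAct_wind_twist (hodd : ∀ j, Odd (P j)) (h2 : ∀ j, 2 ≤ P j) {j : Fin t}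
    {w : Equiv.Perm ℕ} (hw : ∀ x : ZMod (P j), w (str P j x) = str P j x) :
    pairAct w (wind (twist P j)) = wind (twist P j) := by
  rw [wind_twist h2, map_add, map_zsmul, pairAct_pairVec, hw, hw, deltaAt,
    pairAct_wind_deltaBlock (hodd j) (offset_add_le_strands P j) hw]

variable [∀ j, NeZero (P j)]

theorem str_lt_add (j : Fin t) (x : ZMod (P j)) : str P j x < offset P j + P j :=
  Nat.add_lt_add_left x.val_lt _

theorem str_lt (j : Fin t) (x : ZMod (P j)) : str P j x < strands P :=
  (str_lt_add j x).trans_le (offset_add_le_strands P j)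

theorem block_eq_of_str_eq {j h : Fin t} {x : ZMod (P j)} {y : ZMod (P h)}
    (e : str P j x = str P h y) : j = h := by
  have h1 := offset_le_str j x
  have h2 := str_lt_add j x
  have h3 := offset_le_str h y
  have h4 := str_lt_add h y
  rcases lt_trichotomy j h with hl | hl | hl
  · have := offset_add_le P hl
    omega
  · exact hl
  · have := offset_add_le P hl
    omega

theorem str_inj {j : Fin t} {x y : ZMod (P j)} : str P j x = str P j y ↔ x = y := by
  rw [str, str, blockStr, blockStr, Nat.add_left_cancel_iff]
  exact (ZMod.val_injective _).eq_iff

/-- A count: distinct positions in the blocks are distinct strings, and there are as many positions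
as strings. -/
theorem exists_str {a : ℕ} (ha : a < strands P) : ∃ j, ∃ x : ZMod (P j), a = str P j x := by
  have h : (Finset.univ : Finset (Σ j, ZMod (P j))).image (fun z => str P z.1 z.2) =
      Finset.range (strands P) := by
    refine Finset.eq_of_subset_of_card_le ?_ ?_
    · intro b hb
      obtain ⟨z, -, rfl⟩ := Finset.mem_image.1 hb
      exact Finset.mem_range.2 (str_lt _ _)
    · rw [Finset.card_image_of_injective]
      · simp [ZMod.card]
      · rintro ⟨j, x⟩ ⟨h, y⟩ e
        obtain rfl := block_eq_of_str_eq e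
        obtain rfl := str_inj.1 e
        rfl
  have h1 := Finset.mem_range.2 ha
  rw [← h] at h1
  obtain ⟨z, -, rfl⟩ := Finset.mem_image.1 h1
  exact ⟨z.1, z.2, rfl⟩

theorem perm_ext {x y : CrystBraid (strands P)}
    (h : ∀ j (a : ZMod (P j)), permN _ x (str P j a) = permN _ y (str P j a)) :
    permN _ x = permN _ y := by
  ext a
  by_cases ha : a < strands P
  · obtain ⟨j, b, rfl⟩ := exists_str ha
    exact h j b
  · rw [permN_of_ge _ (by omega), permN_of_ge _ (by omega)]

theorem permN_deltaAt (hodd : ∀ j, Odd (P j)) (j h : Fin t) (x : ZMod (P h)) :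
    permN _ (deltaAt P j) (str P h x) = if h = j then str P h (x - 1) else str P h x := by
  split_ifs with e
  · subst e
    exact permN_deltaBlock (hodd h) (offset_add_le_strands P h) x
  · refine permN_deltaBlock_of_notMem (hodd j) (offset_add_le_strands P j) ?_
    have h1 := offset_le_str h x
    have h2 := str_lt_add h x
    rcases lt_or_gt_of_ne e with hl | hl
    · have := offset_add_le P hl
      omega
    · have := offset_add_le P hl
      omega

theorem permN_delta (hodd : ∀ j, Odd (P j)) (h : Fin t) (x : ZMod (P h)) :
    permN _ (delta P) (str P h x) = str P h (x - 1) :=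
  permN_prod_ofFn (permN_deltaAt hodd) h x

variable (P) in
/-- The product of the generators `A_{n_j+1,n_j+2} δ_{n_j,P_j}` of `Γ_q`. -/
def twistProd : CrystBraid (strands P) := (List.ofFn (twist P)).prod

theorem permN_twist (hodd : ∀ j, Odd (P j)) (j h : Fin t) (x : ZMod (P h)) :
    permN _ (twist P j) (str P h x) = if h = j then str P h (x - 1) else str P h x := by
  rw [permN_twist_eq, permN_deltaAt hodd]

theorem permN_twistProd (hodd : ∀ j, Odd (P j)) :
    permN _ (twistProd P) = permN _ (delta P) := by
  refine perm_ext fun j x => ?_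
  rw [permN_delta hodd, twistProd, permN_prod_ofFn (permN_twist hodd)]

theorem permN_delta_pow (hodd : ∀ j, Odd (P j)) (k : ℕ) (h : Fin t) (x : ZMod (P h)) :
    permN _ (delta P ^ k) (str P h x) = str P h (x - k) := by
  rw [map_pow]
  exact perm_pow_blockStr (permN_delta hodd h) k x

/-- The `k`-th power rotates block `j` by `k` steps, hence is trivial exactly when every `P j`
divides `k`; coprimality turns this into divisibility by the product. -/
theorem permN_delta_pow_eq_one_iff (hodd : ∀ j, Odd (P j))
    (hco : Pairwise (Function.onFun Nat.Coprime P)) (k : ℕ) :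
    permN _ (delta P ^ k) = 1 ↔ order P ∣ k := by
  constructor
  · intro h
    refine Fintype.prod_dvd_of_isRelPrime (fun i j hij => Nat.coprime_iff_isRelPrime.1 (hco hij)) fun j => ?_
    have := permN_delta_pow hodd k j 0
    rw [h, Equiv.Perm.one_apply, str_inj, zero_sub, eq_comm, neg_eq_zero] at this
    exact (ZMod.natCast_eq_zero_iff _ _).1 this
  · intro h
    rw [← map_one (permN (strands P))]
    refine perm_ext fun j x => ?_
    rw [permN_delta_pow hodd, (ZMod.natCast_eq_zero_iff k (P j)).2
      ((Finset.dvd_prod_of_mem P (Finset.mem_univ j)).trans h)]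
    simp

variable (P) in
/-- Half the winding numbers of `(A_{n_j+1,n_j+2} δ_{n_j,P_j})^{P_j}`. -/
noncomputable def blockSum (j : Fin t) : PairLattice := orbitSum (offset P j) (P j) 1

theorem blockSum_eq (j : Fin t) :
    blockSum P j = ∑ y : ZMod (P j), pairVec (str P j y) (str P j (y + 1)) := rfl

/-- Any permutation that rotates block `j` sums the winding of the twist to the same value. -/
theorem sum_pairAct_wind_twist (hodd : ∀ j, Odd (P j)) (h2 : ∀ j, 2 ≤ P j) {j : Fin t}
    {w : Equiv.Perm ℕ} (hw : ∀ x : ZMod (P j), w (str P j x) = str P j (x - 1)) :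
    ∑ i ∈ Finset.range (P j), pairAct (w ^ i) (wind (twist P j)) = (2 : ℤ) • blockSum P j := by
  simp only [wind_twist h2, map_add, Finset.sum_add_distrib, map_zsmul]
  rw [deltaAt, sum_pairAct_wind_deltaBlock (hodd j) (offset_add_le_strands P j) hw, add_zero,
    ← Finset.smul_sum, str, str, sum_pairAct_pow hw, sub_zero]
  rfl

end Blocks
-- Basis indices as pairs of strings, and the winding numbers of the basis elements
section Pairs
variable {t : ℕ} (P : Fin t → ℕ)

/-- The hypotheses on the block sizes that are used below. -/
structure OddCoprime : Prop where
  odd : ∀ j, Odd (P j)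
  three_le : ∀ j, 3 ≤ P j
  coprime : Pairwise (Function.onFun Nat.Coprime P)

/-- The position of the first string of the pair `(j, h)` at `k = 0`. -/
def startPos (h : ℕ) : ℕ := if h = 0 then 2 else 0

/-- The pair of strings attached to position `k` in the block `b` of the basis. -/
def pairOf : BlockIdx P → ℕ → Sym2 ℕ
  | Sum.inl ⟨j, h⟩, k => s(str P j (startPos h - k), str P j (startPos h - k + (h.val + 1 : ℕ)))
  | Sum.inr x, k => s(str P x.1.1 (-k), str P x.1.2 (-k))

variable {P}

theorem pairOf_add_size (b : BlockIdx P) (k : ℕ) : pairOf P b (k + blockSize P b) = pairOf P b k := by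
  rcases b with ⟨j, h⟩ | ⟨⟨j, h⟩, hjh⟩ <;> simp [pairOf, blockSize]

theorem permN_conjDelta (k : ℕ) {x : CrystBraid (strands P)} (hx : permN _ x = 1) :
    permN _ (conjDelta P k x) = 1 := by
  rw [conjDelta, map_mul, map_mul, hx, mul_one, map_inv, mul_inv_cancel]

theorem map_pairOf {w : Equiv.Perm ℕ} (hw : ∀ j (x : ZMod (P j)), w (str P j x) = str P j (x - 1))
    (b : BlockIdx P) (k : ℕ) : (pairOf P b k).map w = pairOf P b (k + 1) := by
  rcases b with ⟨j, h⟩ | ⟨⟨j, h⟩, hjh⟩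
  · simp only [pairOf, Sym2.map_mk, hw]
    rw [Nat.cast_succ k, sub_sub, add_sub_right_comm, sub_sub]
  · simp only [pairOf, Sym2.map_mk, hw]
    rw [Nat.cast_succ k, neg_add', Nat.cast_succ k, neg_add']

theorem map_pow_pairOf {w : Equiv.Perm ℕ}
    (hw : ∀ j (x : ZMod (P j)), w (str P j x) = str P j (x - 1))
    (b : BlockIdx P) (k l : ℕ) : (pairOf P b k).map (w ^ l : Equiv.Perm ℕ) = pairOf P b (k + l) := by
  induction l with
  | zero => simp
  | succ l ih =>
    rw [pow_succ', Equiv.Perm.coe_mul, ← Sym2.map_map, ih, map_pairOf hw, add_assoc]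

variable [∀ j, NeZero (P j)]

theorem natCast_inj_of_lt {z a b : ℕ} (ha : a < z) (hb : b < z) (h : (a : ZMod z) = b) : a = b := by
  rwa [ZMod.natCast_eq_natCast_iff', Nat.mod_eq_of_lt ha, Nat.mod_eq_of_lt hb] at h

/-- Inside a block the distances are at most `(P j - 1) / 2`, so two of them never add up to a
multiple of `P j` and an unordered pair determines its distance and its first string. For two
different blocks, `k` is recovered from its residues modulo both sizes by the Chinese remainder
theorem. -/
theorem pairOf_injective (hP : OddCoprime P) :
    Function.Injective fun x : BasisIdx P => pairOf P x.1 x.2 := by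
  rintro ⟨⟨j, h⟩ | ⟨⟨j, h⟩, hjh⟩, k, hk⟩ ⟨⟨j', h'⟩ | ⟨⟨j', h'⟩, hjh'⟩, k', hk'⟩ e
  · simp only [blockSize] at hk hk'
    simp only [pairOf, Sym2.eq_iff] at e
    obtain rfl : j = j' := by
      rcases e with ⟨e, -⟩ | ⟨e, -⟩ <;> exact block_eq_of_str_eq e
    simp only [str_inj] at e
    have h1 := h.2
    have h2 := h'.2
    have h3 := hP.three_le j
    rcases e with ⟨e1, e2⟩ | ⟨e1, e2⟩
    · rw [e1, add_right_inj] at e2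
      have e3 := natCast_inj_of_lt (by omega) (by omega) e2
      obtain rfl : h = h' := Fin.ext (by omega)
      rw [sub_right_inj] at e1
      obtain rfl := natCast_inj_of_lt hk hk' e1
      rfl
    · rw [e1, add_assoc, add_eq_left, ← Nat.cast_add, ZMod.natCast_eq_zero_iff] at e2
      have := Nat.le_of_dvd (by omega) e2
      omega
  · simp only [pairOf, Sym2.eq_iff] at e
    exfalso
    rcases e with ⟨e1, e2⟩ | ⟨e1, e2⟩
    · exact hjh'.ne ((block_eq_of_str_eq e1).symm.trans (block_eq_of_str_eq e2))
    · exact hjh'.ne ((block_eq_of_str_eq e2).symm.trans (block_eq_of_str_eq e1))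
  · simp only [pairOf, Sym2.eq_iff] at e
    exfalso
    rcases e with ⟨e1, e2⟩ | ⟨e1, e2⟩
    · exact hjh.ne ((block_eq_of_str_eq e1).trans (block_eq_of_str_eq e2).symm)
    · exact hjh.ne ((block_eq_of_str_eq e1).trans (block_eq_of_str_eq e2).symm)
  · simp only [blockSize] at hk hk'
    simp only [pairOf, Sym2.eq_iff] at e
    rcases e with ⟨e1, e2⟩ | ⟨e1, e2⟩
    · obtain rfl := block_eq_of_str_eq e1
      obtain rfl := block_eq_of_str_eq e2
      rw [str_inj, neg_inj, ZMod.natCast_eq_natCast_iff] at e1 e2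
      have e3 := (Nat.modEq_and_modEq_iff_modEq_mul (hP.coprime hjh.ne)).1 ⟨e1, e2⟩
      obtain rfl := Nat.ModEq.eq_of_lt_of_lt e3 hk hk'
      rfl
    · have h1 := block_eq_of_str_eq e1
      have h2 := block_eq_of_str_eq e2
      subst h1 h2
      exact absurd hjh hjh'.not_gt

theorem exists_pairOf_same {j : Fin t} (x : ZMod (P j)) {d : ℕ} (h1 : 1 ≤ d)
    (h2 : d ≤ (P j - 1) / 2) :
    ∃ y : BasisIdx P, pairOf P y.1 y.2 = s(str P j x, str P j (x + d)) := by
  refine ⟨⟨Sum.inl ⟨j, ⟨d - 1, by omega⟩⟩,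
    ⟨((startPos (d - 1) : ℕ) - x : ZMod (P j)).val, ZMod.val_lt _⟩⟩, ?_⟩
  simp only [pairOf, ZMod.natCast_zmod_val]
  rw [sub_sub_cancel, Nat.sub_add_cancel h1]

theorem exists_pairOf_of_lt (hP : OddCoprime P) {j h : Fin t} (hjh : j < h) (x : ZMod (P j))
    (y : ZMod (P h)) : ∃ z : BasisIdx P, pairOf P z.1 z.2 = s(str P j x, str P h y) := by
  have hco := hP.coprime hjh.ne
  let k := Nat.chineseRemainder hco (-x).val (-y).val
  refine ⟨⟨Sum.inr ⟨(j, h), hjh⟩, ⟨k, Nat.chineseRemainder_lt_mul hco _ _ (NeZero.ne _)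
    (NeZero.ne _)⟩⟩, ?_⟩
  have h1 : ((k : ℕ) : ZMod (P j)) = -x := by
    rw [(ZMod.natCast_eq_natCast_iff _ _ _).2 k.2.1, ZMod.natCast_zmod_val]
  have h2 : ((k : ℕ) : ZMod (P h)) = -y := by
    rw [(ZMod.natCast_eq_natCast_iff _ _ _).2 k.2.2, ZMod.natCast_zmod_val]
  simp only [pairOf, h1, h2, neg_neg]

theorem exists_pairOf (hP : OddCoprime P) {a b : ℕ} (ha : a < strands P) (hb : b < strands P)
    (hab : a ≠ b) : ∃ z : BasisIdx P, pairOf P z.1 z.2 = s(a, b) := by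
  obtain ⟨j, x, rfl⟩ := exists_str ha
  obtain ⟨h, y, rfl⟩ := exists_str hb
  rcases lt_trichotomy j h with hl | rfl | hl
  · exact exists_pairOf_of_lt hP hl x y
  · have hd : y - x ≠ 0 := fun e => hab (by rw [sub_eq_zero.1 e])
    have h0 : (y - x).val ≠ 0 := fun e => hd ((ZMod.val_eq_zero _).1 e)
    by_cases hle : (y - x).val ≤ (P j - 1) / 2
    · obtain ⟨z, hz⟩ := exists_pairOf_same x (d := (y - x).val) (by omega) hle
      refine ⟨z, hz.trans ?_⟩
      rw [ZMod.natCast_zmod_val, add_sub_cancel]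
    -- Otherwise the complementary distance, from `y` to `x`, is at most `(P j - 1) / 2`, because `P
    -- j` is odd.
    · have := (y - x).val_lt
      have := hP.odd j
      have e1 : (y - x).val + (P j - (y - x).val) = P j := by omega
      obtain ⟨z, hz⟩ := exists_pairOf_same y (d := P j - (y - x).val) (by omega) (by
        obtain ⟨c, hc⟩ := this; omega)
      refine ⟨z, hz.trans ?_⟩
      rw [Nat.cast_sub (by omega), ZMod.natCast_zmod_val, ZMod.natCast_self, Sym2.eq_swap]
      congr 2
      ring
  · rw [Sym2.eq_swap]
    exact exists_pairOf_of_lt hP hl y x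

theorem pairOf_eq_mk (hP : OddCoprime P) (b : BlockIdx P) (k : ℕ) :
    ∃ a < strands P, ∃ a' < strands P, a ≠ a' ∧ pairOf P b k = s(a, a') := by
  rcases b with ⟨j, h⟩ | ⟨⟨j, h⟩, hjh⟩
  · refine ⟨_, str_lt _ _, _, str_lt _ _, ?_, rfl⟩
    rw [Ne, str_inj, eq_comm, add_eq_left, ZMod.natCast_eq_zero_iff]
    intro hd
    have := Nat.le_of_dvd (by omega) hd
    have := h.2
    have := hP.three_le j
    omega
  · exact ⟨_, str_lt _ _, _, str_lt _ _, fun e => hjh.ne (block_eq_of_str_eq e), rfl⟩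

theorem card_basisIdx (hP : OddCoprime P) :
    Fintype.card (BasisIdx P) = strands P * (strands P - 1) / 2 := by
  classical
  rw [← Nat.choose_two_right]
  conv_rhs => rw [← Finset.card_range (strands P), ← Sym2.card_image_offDiag]
  rw [← Finset.card_univ, ← Finset.card_image_of_injective _ (pairOf_injective hP)]
  congr 1
  ext z
  simp only [Finset.mem_image, Finset.mem_univ, true_and, Finset.mem_offDiag, Finset.mem_range,
    Prod.exists]
  constructor
  · rintro ⟨x, rfl⟩
    obtain ⟨a, ha, a', ha', hne, e⟩ := pairOf_eq_mk hP x.1 x.2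
    exact ⟨a, a', ⟨ha, ha', hne⟩, e.symm⟩
  · rintro ⟨a, a', ⟨ha, ha', hne⟩, rfl⟩
    exact exists_pairOf hP ha ha' hne

/-- The block `(j, 0)`. -/
def baseBlock (hP : OddCoprime P) (j : Fin t) : BlockIdx P :=
  Sum.inl ⟨j, ⟨0, by have := hP.three_le j; omega⟩⟩

theorem blockSum_eq_sum_pairOf (hP : OddCoprime P) (j : Fin t) :
    blockSum P j = ∑ k ∈ Finset.range (P j), Finsupp.single (pairOf P (baseBlock hP j) k) 1 := by
  have h := sum_range_natCast (P j) fun i : ZMod (P j) =>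
    pairVec (str P j (2 - i)) (str P j (2 - i + 1))
  rw [blockSum_eq, ← Equiv.sum_comp (Equiv.subLeft (2 : ZMod (P j)))]
  simp only [Equiv.subLeft_apply]
  rw [← h]
  refine Finset.sum_congr rfl fun k _ => ?_
  simp [pairVec, pairOf, baseBlock, startPos]

/-- Whether a basis element is `(A_{n_j+1,n_j+2} δ_{n_j,P_j})^{P_j}`. -/
def IsTwistPos : BlockIdx P → ℕ → Prop
  | Sum.inl ⟨_, h⟩, k => h.val = 0 ∧ k = 0
  | Sum.inr _, _ => False

/-- Conjugation by the `k`-th power of δ rotates the pair, that is, advances its position in the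
orbit by `k`. -/
theorem wind_conjDelta_pureGen (hP : OddCoprime P) (k m l : ℕ) {r s : ℕ} {b : BlockIdx P}
    (hr : 1 ≤ r) (hrs : r < s) (hs : s ≤ strands P) (h : s(r - 1, s - 1) = pairOf P b l) :
    wind (conjDelta P k (pureGen (strands P) r s ^ m)) =
      Finsupp.single (pairOf P b (l + k)) (2 * m : ℤ) := by
  have hp : permN _ (pureGen (strands P) r s ^ m) = 1 := by rw [map_pow, permN_pureGen, one_pow]
  rw [conjDelta, wind_conj _ _ hp, wind_pow_of_permN (permN_pureGen _ _), wind_pureGen hr hrs hs,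
    pairVec, h, map_zsmul, map_zsmul, pairAct_single, map_pow, map_pow_pairOf (permN_delta hP.odd)]
  simp [mul_comm]

theorem permN_twist_pow (hP : OddCoprime P) (j : Fin t) : permN _ (twist P j ^ P j) = 1 := by
  rw [← map_one (permN (strands P))]
  refine perm_ext fun h x => ?_
  rw [map_one, Equiv.Perm.one_apply, map_pow]
  by_cases e : h = j
  · subst e
    have := perm_pow_blockStr (w := permN _ (twist P h)) (m := offset P h) (z := P h) (fun x => by
      have := permN_twist hP.odd h h x
      rwa [if_pos rfl] at this) (P h) x
    rw [ZMod.natCast_self, sub_zero] at this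
    exact this
  · have h1 : ∀ k : ℕ, (permN _ (twist P j) ^ k) (str P h x) = str P h x := by
      intro k
      induction k with
      | zero => rfl
      | succ k ih => rw [pow_succ', Equiv.Perm.mul_apply, ih, permN_twist hP.odd, if_neg e]
    exact h1 _

theorem wind_twist_pow (hP : OddCoprime P) (j : Fin t) :
    wind (twist P j ^ P j) = (2 : ℤ) • blockSum P j := by
  rw [wind_pow]
  refine sum_pairAct_wind_twist hP.odd (fun j => by have := hP.three_le j; omega) fun x => ?_
  rw [permN_twist hP.odd, if_pos rfl]

theorem permN_basisElt (hP : OddCoprime P) (b : BlockIdx P) (k : ℕ) :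
    permN _ (basisElt P b k) = 1 := by
  have hA : ∀ r s, permN _ (pureGen (strands P) r s ^ order P) = 1 := fun r s => by
    rw [map_pow, permN_pureGen, one_pow]
  rcases b with ⟨j, h⟩ | x
  · rw [basisElt]
    split_ifs
    · exact permN_twist_pow hP j
    · exact permN_conjDelta _ (hA _ _)
    · exact permN_conjDelta _ (hA _ _)
  · exact permN_conjDelta _ (hA _ _)

theorem wind_basisElt_baseBlock (hP : OddCoprime P) (j : Fin t) :
    wind (basisElt P (baseBlock hP j) 0) = (2 : ℤ) • blockSum P j :=
  wind_twist_pow hP j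

/-- The shift `startPos` is 2 in the block `(j, 0)` because there A_{n_j+2,n_j+3}, whose strings
have cyclic positions 1 and 2, stands at `k = 1`. The pair left over at `k = 0`, of positions 2 and
3 modulo `P j`, is the one whose slot the power of the twist occupies. -/
theorem wind_basisElt (hP : OddCoprime P) {b : BlockIdx P} {k : ℕ} (h : ¬ IsTwistPos b k) :
    wind (basisElt P b k) = Finsupp.single (pairOf P b k) (2 * order P : ℤ) := by
  rcases b with ⟨j, h'⟩ | ⟨⟨j, h'⟩, hjh⟩
  · have h1 := h'.2
    have h3 := hP.three_le j
    have h4 := offset_add_le_strands P j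
    rw [basisElt]
    split_ifs with e1 e2
    · exact absurd ⟨e1, e2⟩ h
    · obtain ⟨k, rfl⟩ : ∃ i, k = i + 1 := ⟨k - 1, by omega⟩
      rw [wind_conjDelta_pureGen (b := Sum.inl ⟨j, h'⟩) hP _ _ 1 (by omega) (by omega) (by omega),
        add_comm, Nat.add_sub_cancel]
      have a1 := str_natCast (P := P) (j := j) (a := 1) (by omega)
      have a2 := str_natCast (P := P) (j := j) (a := 2) (by omega)
      rw [Nat.cast_one] at a1
      rw [Nat.cast_two] at a2
      simp only [pairOf, startPos, e1]
      norm_num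
      rw [a1, a2]
      simp
    · rw [wind_conjDelta_pureGen (b := Sum.inl ⟨j, h'⟩) hP _ _ 0 (by omega) (by omega) (by omega),
        zero_add]
      have a1 := str_natCast (P := P) (j := j) (a := 0) (by omega)
      have a2 := str_natCast (P := P) (j := j) (a := h'.val + 1) (by omega)
      simp only [pairOf, startPos, if_neg e1]
      rw [sub_self, zero_add, a2, ← Nat.cast_zero, a1]
      rfl
  · have h3 : 3 ≤ P j := hP.three_le j
    have h3' : 3 ≤ P h' := hP.three_le h'
    have h4 : offset P j + P j ≤ offset P h' := offset_add_le P hjh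
    have h5 := offset_add_le_strands P h'
    rw [basisElt, wind_conjDelta_pureGen (b := Sum.inr ⟨(j, h'), hjh⟩) hP _ _ 0 (by omega)
      (by simp only; omega) (by simp only; omega), zero_add]
    have a1 := str_natCast (P := P) (j := j) (a := 0) (by omega)
    have a2 := str_natCast (P := P) (j := h') (a := 0) (by omega)
    rw [Nat.cast_zero] at a1 a2
    simp [pairOf, a1, a2]

end Pairs
-- The winding vectors of the lattice L: generators and basis
section Lattice
variable {t : ℕ} {P : Fin t → ℕ}

theorem twist_mem_Gam (j : Fin t) : twist P j ∈ Gam P :=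
  Subgroup.subset_closure (Or.inl ⟨j, rfl⟩)

theorem twistProd_mem_Gam : twistProd P ∈ Gam P :=
  list_prod_mem fun x hx => by
    obtain ⟨j, rfl⟩ := (List.mem_ofFn' _ _).1 hx
    exact twist_mem_Gam j

/-- A pure element is determined by its winding vector, so this one must be the `q`-th power of some
A_{r,s}. -/
theorem mem_Gam_of_wind {x : CrystBraid (strands P)} (hx : permN _ x = 1) {a b : ℕ}
    (ha : a < strands P) (hb : b < strands P) (hab : a ≠ b)
    (h : wind x = Finsupp.single s(a, b) (2 * order P : ℤ)) : x ∈ Gam P := by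
  wlog hlt : a < b generalizing a b
  · exact this hb ha hab.symm (by rw [h, Sym2.eq_swap]) (by omega)
  have : x = pureGen (strands P) (a + 1) (b + 1) ^ order P := by
    refine ext_wind (by rw [hx, map_pow, permN_pureGen, one_pow]) ?_
    rw [h, wind_pow_of_permN (permN_pureGen _ _), wind_pureGen (by omega) (by omega) (by omega),
      pairVec, smul_smul, Finsupp.smul_single, smul_eq_mul, mul_one, mul_comm]
    simp
  rw [this]
  exact Subgroup.subset_closure (Or.inr ⟨_, _, by omega, by omega, by omega, rfl⟩)

theorem eq_baseBlock_of_isTwistPos (hP : OddCoprime P) {b : BlockIdx P} {k : ℕ}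
    (h : IsTwistPos b k) : ∃ j, b = baseBlock hP j ∧ k = 0 := by
  rcases b with ⟨j, h'⟩ | x
  · obtain ⟨e, rfl⟩ := h
    refine ⟨j, ?_, rfl⟩
    rw [baseBlock]
    congr 2
    exact Fin.ext e
  · exact h.elim

variable [∀ j, NeZero (P j)]

variable (P) in
/-- The winding vectors of `L`: the span of `2 q` times the pairs and of the block sums. -/
noncomputable def windLattice : AddSubgroup PairLattice :=
  AddSubgroup.closure ({v | ∃ a < strands P, ∃ b < strands P, a ≠ b ∧
    v = Finsupp.single s(a, b) (2 * order P : ℤ)} ∪ Set.range fun j => (2 : ℤ) • blockSum P j)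

theorem single_mem_windLattice {a b : ℕ} (ha : a < strands P) (hb : b < strands P) (hab : a ≠ b) :
    Finsupp.single s(a, b) (2 * order P : ℤ) ∈ windLattice P :=
  AddSubgroup.subset_closure (Or.inl ⟨a, ha, b, hb, hab, rfl⟩)

theorem blockSum_mem_windLattice (j : Fin t) : (2 : ℤ) • blockSum P j ∈ windLattice P :=
  AddSubgroup.subset_closure (Or.inr ⟨j, rfl⟩)

theorem permN_lt {n : ℕ} (x : CrystBraid n) {a : ℕ} (ha : a < n) : permN n x a < n := by
  rw [permN_val x ⟨a, ha⟩]
  exact Fin.is_lt _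

theorem pairAct_blockSum (j : Fin t) {w : Equiv.Perm ℕ}
    (hw : ∀ x : ZMod (P j), w (str P j x) = str P j (x - 1)) :
    pairAct w (blockSum P j) = blockSum P j := by
  rw [blockSum_eq, map_sum, ← Equiv.sum_comp (Equiv.addRight (1 : ZMod (P j)))]
  refine Finset.sum_congr rfl fun y _ => ?_
  rw [pairAct_pairVec, hw, hw]
  simp

theorem pairAct_pow_blockSum (j : Fin t) {w : Equiv.Perm ℕ}
    (hw : ∀ x : ZMod (P j), w (str P j x) = str P j (x - 1)) (k : ℕ) :
    pairAct (w ^ k) (blockSum P j) = blockSum P j := by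
  induction k with
  | zero => simp
  | succ k ih => rw [pow_succ, pairAct_mul, pairAct_blockSum j hw, ih]

theorem pairAct_zpow_blockSum (j : Fin t) {w : Equiv.Perm ℕ}
    (hw : ∀ x : ZMod (P j), w (str P j x) = str P j (x - 1)) (k : ℤ) :
    pairAct (w ^ k) (blockSum P j) = blockSum P j := by
  obtain ⟨k, rfl | rfl⟩ := k.eq_nat_or_neg
  · rw [zpow_natCast, pairAct_pow_blockSum j hw]
  · nth_rewrite 1 [← pairAct_pow_blockSum j hw k]
    rw [← pairAct_mul, zpow_neg, zpow_natCast, inv_mul_cancel, pairAct_one]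

theorem pairAct_mem_windLattice (hP : OddCoprime P) (m : ℤ) {v : PairLattice}
    (hv : v ∈ windLattice P) : pairAct (permN _ (delta P ^ m)) v ∈ windLattice P := by
  have : windLattice P ≤ (windLattice P).comap (pairAct (permN _ (delta P ^ m))) := by
    refine (AddSubgroup.closure_le _).2 ?_
    rintro _ (⟨a, ha, b, hb, hab, rfl⟩ | ⟨j, rfl⟩)
    · rw [SetLike.mem_coe, AddSubgroup.mem_comap, pairAct_single, Sym2.map_mk]
      exact single_mem_windLattice (permN_lt _ ha) (permN_lt _ hb) (by simpa using hab)
    · rw [SetLike.mem_coe, AddSubgroup.mem_comap, map_zsmul, map_zpow,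
        pairAct_zpow_blockSum j (permN_delta hP.odd j)]
      exact blockSum_mem_windLattice j
  exact this hv

theorem wind_list_prod_twist (hP : OddCoprime P) : ∀ l : List (Fin t), l.Nodup →
    wind (l.map (twist P)).prod = (l.map fun j => wind (twist P j)).sum
  | [], _ => by simp
  | j :: l, hl => by
    have hl' := List.nodup_cons.1 hl
    rw [List.map_cons, List.prod_cons, wind_mul, wind_list_prod_twist hP l hl'.2, List.map_cons,
      List.sum_cons, map_list_sum, List.map_map]
    congr 2
    refine List.map_congr_left fun h hh => ?_
    refine pairAct_wind_twist hP.odd (fun j => by have := hP.three_le j; omega) fun x => ?_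
    rw [permN_twist hP.odd, if_neg]
    rintro rfl
    exact hl'.1 hh

/-- The cocycle is additive on this product because each twist fixes the strings of all other
blocks. -/
theorem wind_twistProd (hP : OddCoprime P) : wind (twistProd P) = ∑ j, wind (twist P j) := by
  rw [twistProd, List.ofFn_eq_map, wind_list_prod_twist hP _ (List.nodup_finRange t),
    ← List.ofFn_eq_map, List.sum_ofFn]

theorem sum_range_mul_pairAct_wind_twist (hP : OddCoprime P) (j : Fin t) {w : Equiv.Perm ℕ}
    (hw : ∀ x : ZMod (P j), w (str P j x) = str P j (x - 1)) (k : ℕ) :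
    ∑ i ∈ Finset.range (P j * k), pairAct (w ^ i) (wind (twist P j)) =
      (k : ℤ) • ((2 : ℤ) • blockSum P j) := by
  induction k with
  | zero => simp
  | succ k ih =>
    rw [mul_add, mul_one, Finset.sum_range_add, ih]
    simp only [pow_add, pairAct_mul]
    rw [← map_sum, sum_pairAct_wind_twist hP.odd
      (fun j => by have := hP.three_le j; omega) hw, map_zsmul, pairAct_pow_blockSum j hw]
    push_cast
    rw [add_smul, one_smul]

theorem wind_twistProd_pow (hP : OddCoprime P) (m : ℕ) : wind (twistProd P ^ m) =
    ∑ j, ∑ i ∈ Finset.range m, pairAct (permN _ (delta P) ^ i) (wind (twist P j)) := by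
  rw [wind_pow, permN_twistProd hP.odd, wind_twistProd hP, Finset.sum_comm]
  simp only [map_sum]

theorem sum_range_mem_windLattice (hP : OddCoprime P) {j : Fin t} {m : ℕ} (h : P j ∣ m) :
    ∑ i ∈ Finset.range m, pairAct (permN _ (delta P) ^ i) (wind (twist P j)) ∈ windLattice P := by
  obtain ⟨k, rfl⟩ := h
  rw [sum_range_mul_pairAct_wind_twist hP j (permN_delta hP.odd j)]
  exact zsmul_mem (blockSum_mem_windLattice j) _

/-- The exponent is 1 modulo `P j` and 0 modulo the other sizes. The other blocks then make full
turns, which contribute multiples of their doubled block sums; block `j` makes full turns and one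
more step, which contributes the winding of the twist up to such a multiple. -/
theorem exists_twistProd_pow (hP : OddCoprime P) (j : Fin t) : ∃ m : ℕ,
    permN _ (twist P j) = permN _ (delta P ^ m) ∧
      wind (twist P j) - wind (twistProd P ^ m) ∈ windLattice P := by
  classical
  have hco : Nat.Coprime (P j) (∏ i ∈ Finset.univ.erase j, P i) :=
    Nat.Coprime.prod_right fun i hi => hP.coprime (Finset.ne_of_mem_erase hi).symm
  obtain ⟨m, hm1, hm0⟩ := Nat.chineseRemainder hco 1 0
  have hd : ∀ h, h ≠ j → P h ∣ m := fun h hh =>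
    (Finset.dvd_prod_of_mem P (Finset.mem_erase.2 ⟨hh, Finset.mem_univ h⟩)).trans
      ((Nat.modEq_zero_iff_dvd).1 hm0)
  obtain ⟨k, rfl⟩ : ∃ k, m = P j * k + 1 := by
    have h3 := hP.three_le j
    refine ⟨m / P j, ?_⟩
    have h1 : m % P j = 1 := by rw [hm1, Nat.mod_eq_of_lt (by omega)]
    have := Nat.div_add_mod m (P j)
    omega
  refine ⟨P j * k + 1, ?_, ?_⟩
  · refine perm_ext fun h x => ?_
    rw [permN_twist hP.odd, permN_delta_pow hP.odd]
    split_ifs with e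
    · subst e
      simp
    · rw [(ZMod.natCast_eq_zero_iff _ _).2 (hd h e), sub_zero]
  · rw [wind_twistProd_pow hP, ← Finset.add_sum_erase _ _ (Finset.mem_univ j), ← sub_sub]
    refine sub_mem ?_ (sum_mem fun h hh =>
      sum_range_mem_windLattice hP (hd h (Finset.ne_of_mem_erase hh)))
    rw [add_comm (P j * k) 1, Finset.sum_range_add, Finset.sum_range_one, pow_zero, pairAct_one,
      sub_add_eq_sub_sub, sub_self, zero_sub]
    simp only [pow_add, pow_one, pairAct_mul]
    rw [← map_sum, sum_range_mul_pairAct_wind_twist hP j (permN_delta hP.odd j), map_zsmul,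
      map_zsmul, pairAct_blockSum j (permN_delta hP.odd j)]
    exact neg_mem (zsmul_mem (blockSum_mem_windLattice j) _)

theorem permN_twistProd_zpow (hP : OddCoprime P) (m : ℤ) :
    permN _ (twistProd P ^ m) = permN _ (delta P ^ m) := by
  rw [map_zpow, permN_twistProd hP.odd, map_zpow]

/-- Modulo the lattice, `Γ_q` consists of the powers of `twistProd`. -/
theorem exists_zpow_of_mem_Gam (hP : OddCoprime P) {x : CrystBraid (strands P)} (hx : x ∈ Gam P) :
    ∃ m : ℤ, permN _ x = permN _ (delta P ^ m) ∧
      wind x - wind (twistProd P ^ m) ∈ windLattice P := by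
  induction hx using Subgroup.closure_induction with
  | mem x hx =>
    rcases hx with ⟨j, rfl⟩ | ⟨r, s, hr, hrs, hs, rfl⟩
    · obtain ⟨m, h1, h2⟩ := exists_twistProd_pow hP j
      exact ⟨m, by rwa [zpow_natCast], by rwa [zpow_natCast]⟩
    · refine ⟨0, by rw [map_pow, permN_pureGen, one_pow, zpow_zero, map_one], ?_⟩
      rw [zpow_zero, wind_one, sub_zero, wind_pow_of_permN (permN_pureGen _ _),
        wind_pureGen hr hrs hs, pairVec, smul_smul, Finsupp.smul_single, smul_eq_mul, mul_one,
        mul_comm]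
      exact single_mem_windLattice (by omega) (by omega) (by omega)
  | one => exact ⟨0, by simp, by simp [zero_mem]⟩
  | mul x y _ _ ihx ihy =>
    obtain ⟨m, h1, h2⟩ := ihx
    obtain ⟨m', h1', h2'⟩ := ihy
    refine ⟨m + m', by rw [map_mul, h1, h1', ← map_mul, zpow_add], ?_⟩
    rw [zpow_add, wind_mul, wind_mul, h1, permN_twistProd_zpow hP, add_sub_add_comm, ← map_sub]
    exact add_mem h2 (pairAct_mem_windLattice hP m h2')
  | inv x _ ih =>
    obtain ⟨m, h1, h2⟩ := ih
    refine ⟨-m, by rw [map_inv, h1, ← map_inv, zpow_neg], ?_⟩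
    rw [zpow_neg, wind_inv, wind_inv, h1, permN_twistProd_zpow hP, neg_sub_neg, ← map_sub,
      ← map_inv, ← zpow_neg, ← neg_sub, map_neg]
    exact neg_mem (pairAct_mem_windLattice hP (-m) h2)

theorem permN_delta_zpow_eq_one_iff (hP : OddCoprime P) (m : ℤ) :
    permN _ (delta P ^ m) = 1 ↔ (order P : ℤ) ∣ m := by
  have h : orderOf (permN _ (delta P)) = order P := by
    refine Nat.dvd_antisymm ?_ ?_
    · rw [orderOf_dvd_iff_pow_eq_one, ← map_pow, permN_delta_pow_eq_one_iff hP.odd hP.coprime]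
    · rw [← permN_delta_pow_eq_one_iff hP.odd hP.coprime, map_pow, pow_orderOf_eq_one]
  rw [map_zpow, ← orderOf_dvd_iff_zpow_eq_one, h]

/-- Up to the lattice the winding is that of `twistProd P ^ m`, and a trivial permutation forces `q`
to divide `m`. The `q`-th power makes full turns in every block, so its winding lies in the lattice
too. -/
theorem wind_mem_windLattice (hP : OddCoprime P) {x : CrystBraid (strands P)} (hx : x ∈ Gam P)
    (h1 : permN _ x = 1) : wind x ∈ windLattice P := by
  obtain ⟨m, hm, h⟩ := exists_zpow_of_mem_Gam hP hx
  rw [h1, eq_comm, permN_delta_zpow_eq_one_iff hP] at hm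
  obtain ⟨u, rfl⟩ := hm
  have hq : permN _ (twistProd P ^ order P) = 1 := by
    have := permN_twistProd_zpow hP (order P)
    rw [zpow_natCast] at this
    rw [this]
    exact (permN_delta_zpow_eq_one_iff hP _).2 dvd_rfl
  have h2 : wind (twistProd P ^ order P) ∈ windLattice P := by
    rw [wind_twistProd_pow hP]
    exact sum_mem fun j _ =>
      sum_range_mem_windLattice hP (Finset.dvd_prod_of_mem P (Finset.mem_univ j))
  rw [zpow_mul, zpow_natCast, wind_zpow_of_permN hq] at h
  simpa using add_mem h (zsmul_mem h2 u)

variable (P) in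
theorem order_ne_zero : (order P : ℤ) ≠ 0 := by
  rw [Nat.cast_ne_zero]
  exact Finset.prod_ne_zero_iff.2 fun j _ => NeZero.ne _

/-- Membership of δ itself in Γ_q is not needed: a conjugate of A_{r,s}^q by a power of δ is
recognised by its winding as the `q`-th power of another generator. -/
theorem basisElt_mem_Gam (hP : OddCoprime P) (b : BlockIdx P) (k : ℕ) :
    basisElt P b k ∈ Gam P := by
  by_cases h : IsTwistPos b k
  · obtain ⟨j, rfl, rfl⟩ := eq_baseBlock_of_isTwistPos hP h
    exact pow_mem (twist_mem_Gam j) _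
  · obtain ⟨a, ha, a', ha', hne, e⟩ := pairOf_eq_mk hP b k
    refine mem_Gam_of_wind (permN_basisElt hP b k) ha ha' hne ?_
    rw [wind_basisElt hP h, e]

/-- `q` times the class of the twist is the sum of an orbit. -/
theorem single_pairOf_baseBlock (hP : OddCoprime P) (j : Fin t) :
    Finsupp.single (pairOf P (baseBlock hP j) 0) (2 * order P : ℤ) =
      (order P : ℤ) • wind (basisElt P (baseBlock hP j) 0) -
        ∑ k ∈ Finset.range (P j - 1), wind (basisElt P (baseBlock hP j) (k + 1)) := by
  have h1 : ∀ k, wind (basisElt P (baseBlock hP j) (k + 1)) =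
      Finsupp.single (pairOf P (baseBlock hP j) (k + 1)) (2 * order P : ℤ) := fun k =>
    wind_basisElt hP (by simp [IsTwistPos, baseBlock])
  obtain ⟨z, hz⟩ : ∃ z, P j = z + 1 := ⟨P j - 1, by have := hP.three_le j; omega⟩
  rw [wind_basisElt_baseBlock, blockSum_eq_sum_pairOf hP, hz, Finset.sum_range_succ',
    Nat.add_sub_cancel]
  simp only [h1, smul_add, Finset.smul_sum, Finsupp.smul_single, smul_eq_mul,
    mul_comm (2 : ℤ)]
  exact (add_sub_cancel_left _ _).symm

/-- The only pairs that do not come directly from a basis element are those whose slot holds a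
twist; `single_pairOf_baseBlock` recovers them. -/
theorem windLattice_le_span (hP : OddCoprime P) {v : PairLattice} (hv : v ∈ windLattice P) :
    v ∈ Submodule.span ℤ (Set.range fun x : BasisIdx P => wind (basisElt P x.1 x.2)) := by
  set S := Submodule.span ℤ (Set.range fun x : BasisIdx P => wind (basisElt P x.1 x.2))
  have hS : ∀ b k, k < blockSize P b → wind (basisElt P b k) ∈ S := fun b k hk =>
    Submodule.subset_span ⟨⟨b, k, hk⟩, rfl⟩
  have h0 : ∀ j, wind (basisElt P (baseBlock hP j) 0) ∈ S := fun j =>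
    hS _ _ (Nat.pos_of_ne_zero (NeZero.ne (P j)))
  have : windLattice P ≤ S.toAddSubgroup := by
    refine (AddSubgroup.closure_le _).2 ?_
    rintro _ (⟨a, ha, b, hb, hab, rfl⟩ | ⟨j, rfl⟩)
    · obtain ⟨⟨b, k⟩, e⟩ := exists_pairOf hP ha hb hab
      rw [← e]
      by_cases h : IsTwistPos b k
      · obtain ⟨j, rfl, hk⟩ := eq_baseBlock_of_isTwistPos hP h
        simp only [hk]
        rw [single_pairOf_baseBlock]
        refine sub_mem (S.smul_mem _ (h0 j)) (sum_mem fun i hi => hS _ _ ?_)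
        rw [Finset.mem_range] at hi
        change i + 1 < P j
        omega
      · rw [← wind_basisElt hP h]
        exact hS _ _ k.2
    · change (2 : ℤ) • blockSum P j ∈ S
      rw [← wind_basisElt_baseBlock hP]
      exact h0 j
  exact this hv

/-- The system is triangular. The pair at position 0 of the block `(j, 0)` occurs only in the
winding of the twist power of block `j`, with coefficient 2, so the twist coefficients vanish first.
What remains is diagonal with entries `2 q`. -/
theorem linearIndependent_wind (hP : OddCoprime P) :
    LinearIndependent ℤ fun x : BasisIdx P => wind (basisElt P x.1 x.2) := by
  classical
  rw [Fintype.linearIndependent_iff]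
  intro g hg
  have hq := order_ne_zero P
  have hev : ∀ y : BasisIdx P,
      ∑ x, g x * (wind (basisElt P x.1 x.2)) (pairOf P y.1 y.2) = 0 := fun y => by
    have := DFunLike.congr_fun hg (pairOf P y.1 y.2)
    simpa [Finsupp.finsetSum_apply] using this
  have hval : ∀ x y : BasisIdx P, ¬ IsTwistPos x.1 x.2 → x ≠ y →
      (wind (basisElt P x.1 x.2)) (pairOf P y.1 y.2) = 0 := fun x y hx hxy => by
    rw [wind_basisElt hP hx, Finsupp.single_eq_of_ne]
    exact fun e => hxy (pairOf_injective hP e.symm)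
  have htw : ∀ x, IsTwistPos x.1 (x.2 : ℕ) → g x = 0 := by
    rintro ⟨b, k, hk⟩ hx
    obtain ⟨j, rfl, hk0⟩ := eq_baseBlock_of_isTwistPos hP hx
    simp only at hk0
    subst hk0
    have h := hev ⟨baseBlock hP j, 0, hk⟩
    rw [Finset.sum_eq_single ⟨baseBlock hP j, 0, hk⟩] at h
    · rw [wind_basisElt_baseBlock, blockSum_eq_sum_pairOf hP] at h
      have hc : (∑ k ∈ Finset.range (P j),
          (Finsupp.single (pairOf P (baseBlock hP j) k) (1 : ℤ)))
            (pairOf P (baseBlock hP j) 0) = 1 := by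
        rw [Finsupp.finsetSum_apply, Finset.sum_eq_single 0]
        · simp
        · intro i hi hi0
          rw [Finsupp.single_eq_of_ne]
          intro e
          have := @pairOf_injective t P _ hP ⟨baseBlock hP j, 0, hk⟩
            ⟨baseBlock hP j, i, Finset.mem_range.1 hi⟩ e
          simp only [Sigma.mk.injEq, heq_eq_eq, true_and, Fin.mk.injEq] at this
          exact hi0 this.symm
        · intro h0
          exact absurd (Finset.mem_range.2 hk) h0
      rw [Finsupp.smul_apply, hc] at h
      simpa using h
    · intro x _ hxy
      by_cases hxt : IsTwistPos x.1 (x.2 : ℕ)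
      · obtain ⟨b, i, hi⟩ := x
        obtain ⟨j', rfl, hk0⟩ := eq_baseBlock_of_isTwistPos hP hxt
        simp only at hk0
        subst hk0
        simp only
        rw [wind_basisElt_baseBlock, blockSum_eq_sum_pairOf hP, Finsupp.smul_apply,
          Finsupp.finsetSum_apply, Finset.sum_eq_zero, smul_zero, mul_zero]
        intro i hi'
        rw [Finsupp.single_eq_of_ne]
        intro e
        have := @pairOf_injective t P _ hP ⟨baseBlock hP j, 0, hk⟩
            ⟨baseBlock hP j', i, Finset.mem_range.1 hi'⟩ e
        have h1 : baseBlock hP j = baseBlock hP j' := congrArg Sigma.fst this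
        have h2 : j = j' := by
          simp only [baseBlock, Sum.inl.injEq] at h1
          exact congrArg Sigma.fst h1
        subst h2
        exact hxy rfl
      · rw [hval x _ hxt hxy, mul_zero]
    · simp
  intro y
  by_cases hy : IsTwistPos y.1 (y.2 : ℕ)
  · exact htw y hy
  · have h := hev y
    rw [Finset.sum_eq_single y] at h
    · rw [wind_basisElt hP hy, Finsupp.single_eq_same] at h
      exact (mul_eq_zero.1 h).resolve_right (mul_ne_zero two_ne_zero hq)
    · intro x _ hxy
      by_cases hxt : IsTwistPos x.1 (x.2 : ℕ)
      · rw [htw x hxt, zero_mul]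
      · rw [hval x y hxt hxy, mul_zero]
    · simp

end Lattice
-- The holonomy group, its representation and the matrix of θ
section Holonomy
variable {t : ℕ} {P : Fin t → ℕ}

theorem permN_of_mem_lattice (x : lattice P) :
    permN _ ((x : Gam P) : CrystBraid (strands P)) = 1 :=
  permN_eq_one_iff.2 x.2

variable (P) in
/-- Winding numbers on the lattice. -/
noncomputable def latticeWind : Additive (lattice P) →ₗ[ℤ] PairLattice :=
  AddMonoidHom.toIntLinearMap
    { toFun := fun x => wind ((x.toMul : Gam P) : CrystBraid (strands P))
      map_zero' := wind_one
      map_add' := fun x _ => wind_add_of_permN (permN_of_mem_lattice x.toMul) _ }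

theorem latticeWind_apply (x : Additive (lattice P)) :
    latticeWind P x = wind ((x.toMul : Gam P) : CrystBraid (strands P)) := rfl

theorem latticeWind_injective : Function.Injective (latticeWind P) := by
  intro x y h
  apply Additive.toMul.injective
  apply Subtype.ext
  apply Subtype.ext
  exact ext_wind (by rw [permN_of_mem_lattice, permN_of_mem_lattice]) h

/-- The embedding of L into the pair lattice is equivariant, so questions about the representation
become questions about permuting pairs. -/
theorem latticeWind_holonomyRep (g : Gam P) (x : Additive (lattice P)) :
    latticeWind P (holonomyRep P (QuotientGroup.mk g) x) =
      pairAct (permN _ (g : CrystBraid (strands P))) (latticeWind P x) := by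
  rw [latticeWind_apply, latticeWind_apply, ← wind_conj _ _ (permN_of_mem_lattice x.toMul)]
  rfl

theorem holonomyPerm_injective : Function.Injective (holonomyPerm P) :=
  QuotientGroup.kerLift_injective _

theorem holonomyPerm_mk (g : Gam P) : holonomyPerm P (QuotientGroup.mk g) =
    crystPerm _ (g : CrystBraid (strands P)) := rfl

variable (P) in
/-- The generator of the holonomy group. -/
def theta : Holonomy P := QuotientGroup.mk ⟨twistProd P, twistProd_mem_Gam⟩

variable [∀ j, NeZero (P j)]

/-- The elements of the basis, in the lattice. -/
def latticeElt (hP : OddCoprime P) (x : BasisIdx P) : Additive (lattice P) :=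
  Additive.ofMul ⟨⟨basisElt P x.1 x.2, basisElt_mem_Gam hP _ _⟩,
    permN_eq_one_iff.1 (permN_basisElt hP _ _)⟩

theorem latticeWind_latticeElt (hP : OddCoprime P) (x : BasisIdx P) :
    latticeWind P (latticeElt hP x) = wind (basisElt P x.1 x.2) := rfl

/-- The basis of the lattice. -/
noncomputable def latticeBasis (hP : OddCoprime P) :
    Module.Basis (BasisIdx P) ℤ (Additive (lattice P)) :=
  Module.Basis.mk (v := latticeElt hP)
    (LinearIndependent.of_comp (latticeWind P) (linearIndependent_wind hP)) (by
      intro x _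
      have h := windLattice_le_span hP
        (wind_mem_windLattice hP (x.toMul : Gam P).2 (permN_of_mem_lattice x.toMul))
      have e : (Set.range fun x : BasisIdx P => wind (basisElt P x.1 x.2)) =
          latticeWind P '' Set.range (latticeElt hP) := by
        rw [← Set.range_comp]
        rfl
      rw [e, ← Submodule.map_span] at h
      obtain ⟨y, hy, hyx⟩ := h
      rwa [latticeWind_injective hyx] at hy)

theorem latticeBasis_apply (hP : OddCoprime P) (x : BasisIdx P) :
    latticeBasis hP x = latticeElt hP x := Module.Basis.mk_apply _ _ x

/-- The class is represented by the product of the twists, which visibly lies in Γ_q and has the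
same permutation as δ. -/
theorem holonomyPerm_theta (hP : OddCoprime P) :
    holonomyPerm P (theta P) = crystPerm (strands P) (delta P) :=
  permN_eq_iff.1 (permN_twistProd hP.odd)

theorem mem_zpowers_theta (hP : OddCoprime P) (g : Holonomy P) :
    g ∈ Subgroup.zpowers (theta P) := by
  induction g using QuotientGroup.induction_on with
  | H x =>
  obtain ⟨m, hm, -⟩ := exists_zpow_of_mem_Gam hP x.2
  refine ⟨m, holonomyPerm_injective ?_⟩
  simp only
  rw [map_zpow, holonomyPerm_theta hP, holonomyPerm_mk, ← map_zpow]
  exact permN_eq_iff.1 hm.symm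

theorem card_holonomy (hP : OddCoprime P) : Nat.card (Holonomy P) = order P := by
  have h1 : Subgroup.zpowers (theta P) = ⊤ :=
    eq_top_iff.2 fun g _ => mem_zpowers_theta hP g
  rw [← Subgroup.card_top, ← h1, Nat.card_zpowers]
  refine Nat.dvd_antisymm ?_ ?_
  · rw [orderOf_dvd_iff_pow_eq_one]
    apply holonomyPerm_injective
    rw [map_pow, holonomyPerm_theta hP, map_one, ← map_pow, ← permN_eq_one_iff,
      permN_delta_pow_eq_one_iff hP.odd hP.coprime]
  · rw [← permN_delta_pow_eq_one_iff hP.odd hP.coprime, permN_eq_one_iff, map_pow,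
      ← holonomyPerm_theta hP, ← map_pow, pow_orderOf_eq_one, map_one]

/-- Since L contains all A_{r,s}^q, an element acting trivially preserves every unordered pair of
strings; with at least three strings its permutation is trivial. -/
theorem holonomyRep_injective (hP : OddCoprime P) : Function.Injective (holonomyRep P) := by
  refine (injective_iff_map_eq_one (holonomyRep P)).2 fun g hg => ?_
  induction g using QuotientGroup.induction_on with
  | H x =>
  set w := permN _ (x : CrystBraid (strands P)) with hw
  have hpair : ∀ a b, a < b → b < strands P → s(w a, w b) = s(a, b) := by
    intro a b hab hb
    have hp : permN _ (pureGen (strands P) (a + 1) (b + 1) ^ order P) = 1 := by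
      rw [map_pow, permN_pureGen, one_pow]
    let y : lattice P := ⟨⟨pureGen (strands P) (a + 1) (b + 1) ^ order P,
      Subgroup.subset_closure (Or.inr ⟨_, _, by omega, by omega, by omega, rfl⟩)⟩,
      permN_eq_one_iff.1 hp⟩
    have h1 := latticeWind_holonomyRep x (Additive.ofMul y)
    rw [hg] at h1
    have h2 : latticeWind P (Additive.ofMul y) = Finsupp.single s(a, b) (order P * 2 : ℤ) := by
      rw [latticeWind_apply]
      change wind (pureGen (strands P) (a + 1) (b + 1) ^ order P) = _
      rw [wind_pow_of_permN (permN_pureGen _ _), wind_pureGen (by omega) (by omega) (by omega),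
        pairVec, smul_smul, Finsupp.smul_single, smul_eq_mul, mul_one]
      rfl
    rw [Module.End.one_apply, h2, pairAct_single, Sym2.map_mk,
      Finsupp.single_left_inj (mul_ne_zero (order_ne_zero P) two_ne_zero)] at h1
    exact h1.symm
  have hpair' : ∀ a b, a ≠ b → a < strands P → b < strands P → s(w a, w b) = s(a, b) := by
    intro a b hab ha hb
    rcases lt_or_gt_of_ne hab with h | h
    · exact hpair a b h hb
    · rw [Sym2.eq_swap, hpair b a h ha, Sym2.eq_swap]
  have hw1 : w = permN (strands P) 1 := by
    refine perm_ext fun j z => ?_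
    rw [map_one, Equiv.Perm.one_apply]
    have ha := str_lt j z
    generalize str P j z = a at ha ⊢
    have h3 : 3 ≤ strands P := by
      have := hP.three_le j
      have := offset_add_le_strands P j
      omega
    change w a = a
    by_contra hne
    -- A third string `b`, different from `a` and `w a`: from {w a, w b} = {a, b} it follows that `w
    -- a = a`.
    obtain ⟨b, hb, hba, hbw⟩ : ∃ b < strands P, b ≠ a ∧ b ≠ w a := by
      by_contra! h
      have h0 := h 0 (by omega)
      have h1 := h 1 (by omega)
      have h2 := h 2 (by omega)
      omega
    rcases Sym2.eq_iff.1 (hpair' a b hba.symm ha hb) with h | h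
    · exact hne h.1
    · exact hbw h.1.symm
  apply holonomyPerm_injective
  rw [holonomyPerm_mk, map_one, ← permN_eq_one_iff, ← hw, hw1, map_one]

theorem sum_matM_smul {M : Type*} [AddCommGroup M] {z : ℕ} (f : ℕ → M) (k : Fin z) :
    ∑ i : Fin z, matM z i k • f i = f ((k.val + 1) % z) := by
  rw [Finset.sum_eq_single ⟨(k.val + 1) % z, Nat.mod_lt _ k.pos⟩]
  · simp [matM]
  · intro l _ hl
    have : l.val ≠ (k.val + 1) % z := fun e => hl (Fin.ext e)
    simp [matM, this]
  · simp

theorem sum_matN_smul {M : Type*} [AddCommGroup M] {z : ℕ} (hz : 2 ≤ z) (q : ℤ) (f : ℕ → M)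
    (k : Fin z) : ∑ i : Fin z, matN z q i k • f i =
      if k.val + 1 = z then q • f 0 - ∑ i ∈ Finset.range (z - 1), f (i + 1)
      else if k.val = 0 then f 0 else f (k + 1) := by
  have hk := k.2
  split_ifs with h1 h2
  · obtain ⟨z, rfl⟩ : ∃ y, z = y + 1 := ⟨z - 1, by omega⟩
    rw [Fin.sum_univ_succ, Nat.add_sub_cancel, ← Fin.sum_univ_eq_sum_range (fun i => f (i + 1))]
    have h2 : k = Fin.last z := Fin.ext (by simpa using h1)
    have h3 : z ≠ 0 := by omega
    simp [matN, h2, sub_eq_add_neg]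
  · rw [Finset.sum_eq_single ⟨0, by omega⟩]
    · simp [matN, h2, show 1 ≠ z by omega]
    · intro l _ hl
      have : l.val ≠ 0 := fun e => hl (Fin.ext e)
      simp [matN, h2, show 1 ≠ z by omega, this]
    · simp
  · rw [Finset.sum_eq_single ⟨k.val + 1, by omega⟩]
    · simp [matN, h1, h2]
    · intro l _ hl
      have : l.val ≠ k.val + 1 := fun e => hl (Fin.ext e)
      simp [matN, h1, h2, this]
    · simp

theorem pairAct_single_pairOf (hP : OddCoprime P) (b : BlockIdx P) {k : ℕ} (hk : k < blockSize P b)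
    (c : ℤ) : pairAct (permN _ (delta P)) (Finsupp.single (pairOf P b k) c) =
      Finsupp.single (pairOf P b ((k + 1) % blockSize P b)) c := by
  rw [pairAct_single, map_pairOf (permN_delta hP.odd)]
  rcases Nat.lt_or_ge (k + 1) (blockSize P b) with h | h
  · rw [Nat.mod_eq_of_lt h]
  · obtain e : k + 1 = 0 + blockSize P b := by omega
    rw [e, pairOf_add_size, zero_add, Nat.mod_self]

theorem pairAct_wind_basisElt_matM (hP : OddCoprime P) (b : BlockIdx P)
    (h : ∀ k, ¬ IsTwistPos b k) (k : Fin (blockSize P b)) :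
    pairAct (permN _ (delta P)) (wind (basisElt P b k)) =
      ∑ i : Fin (blockSize P b), matM (blockSize P b) i k • wind (basisElt P b i) := by
  rw [sum_matM_smul fun i => wind (basisElt P b i)]
  simp only [wind_basisElt hP (h _)]
  exact pairAct_single_pairOf hP b k.2 _

/-- The twist power is fixed because the block sum is rotation invariant, and the middle vectors are
shifted. The last one moves to the pair at position 0, which is not in the basis and is expanded by
`single_pairOf_baseBlock`. -/
theorem pairAct_wind_basisElt_matN (hP : OddCoprime P) (j : Fin t) (k : Fin (P j)) :
    pairAct (permN _ (delta P)) (wind (basisElt P (baseBlock hP j) k)) =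
      ∑ i : Fin (P j), matN (P j) (order P) i k • wind (basisElt P (baseBlock hP j) i) := by
  have h3 := hP.three_le j
  have hk := k.2
  have hnt : ∀ i, i ≠ 0 → ¬ IsTwistPos (baseBlock hP j) i := fun i hi hp => hi hp.2
  rw [sum_matN_smul (by omega) _ fun i => wind (basisElt P (baseBlock hP j) i)]
  split_ifs with h1 h2
  · have := pairAct_single_pairOf hP (baseBlock hP j) hk (2 * order P)
    rw [wind_basisElt hP (hnt k (by omega)), this, ← single_pairOf_baseBlock hP j, h1]
    change Finsupp.single (pairOf P (baseBlock hP j) (P j % P j)) _ = _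
    rw [Nat.mod_self]
  · rw [h2, wind_basisElt_baseBlock, map_zsmul, pairAct_blockSum j (permN_delta hP.odd j)]
  · have := pairAct_single_pairOf hP (baseBlock hP j) hk (2 * order P)
    rw [wind_basisElt hP (hnt k h2), this, wind_basisElt hP (hnt _ (Nat.succ_ne_zero _))]
    change Finsupp.single (pairOf P (baseBlock hP j) ((k + 1) % P j)) _ = _
    rw [Nat.mod_eq_of_lt (by omega)]

theorem pairAct_wind_basisElt (hP : OddCoprime P) (b : BlockIdx P) (k : Fin (blockSize P b)) :
    pairAct (permN _ (delta P)) (wind (basisElt P b k)) =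
      ∑ i : Fin (blockSize P b), blockMat P b i k • wind (basisElt P b i) := by
  rcases b with ⟨j, h⟩ | x
  · by_cases h0 : h.val = 0
    · have e : blockMat P (Sum.inl ⟨j, h⟩) = matN (P j) (order P) := if_pos h0
      rw [e]
      obtain ⟨h, hh⟩ := h
      obtain rfl : h = 0 := h0
      exact pairAct_wind_basisElt_matN hP j k
    · have e : blockMat P (Sum.inl ⟨j, h⟩) = matM (P j) := if_neg h0
      rw [e]
      exact pairAct_wind_basisElt_matM hP (Sum.inl ⟨j, h⟩) (fun k hk => h0 (And.left hk)) k
  · exact pairAct_wind_basisElt_matM hP (Sum.inr x) (fun k hk => hk) k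

theorem toMatrix_holonomyRep (hP : OddCoprime P) :
    LinearMap.toMatrix (latticeBasis hP) (latticeBasis hP) (holonomyRep P (theta P)) =
      Matrix.blockDiagonal' (blockMat P) := by
  rw [← LinearEquiv.eq_symm_apply, LinearMap.toMatrix_symm]
  refine (latticeBasis hP).ext fun x => latticeWind_injective ?_
  rw [Matrix.toLin_self, theta, latticeWind_holonomyRep, map_sum]
  simp only [map_smul, latticeBasis_apply, latticeWind_latticeElt]
  rw [permN_twistProd hP.odd, pairAct_wind_basisElt hP, Fintype.sum_sigma,
    Finset.sum_eq_single x.1]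
  · refine Finset.sum_congr rfl fun i _ => ?_
    obtain ⟨b, k⟩ := x
    rw [Matrix.blockDiagonal'_apply_eq]
  · intro b _ hb
    obtain ⟨b', k⟩ := x
    refine Finset.sum_eq_zero fun i _ => ?_
    rw [Matrix.blockDiagonal'_apply_ne _ _ _ hb, zero_smul]
  · simp

end Holonomy

/-- Every block size divides 3 and is at least 3, and coprimality allows only one block; `t = 0`
would give `q = 1`. -/
theorem exists_reindex_blockDiagonal'_of_order_eq_three {t : ℕ} {P : Fin t → ℕ} (hP : OddCoprime P)
    (h : order P = 3) : ∃ f : BasisIdx P ≃ Fin 3, (∀ x, (f x).val = x.2.val) ∧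
      Matrix.reindex f f (Matrix.blockDiagonal' (blockMat P)) =
        !![1, 0, 3; 0, 0, -1; 0, 1, -1] := by
  have h3 : ∀ j, P j = 3 := fun j =>
    le_antisymm (Nat.le_of_dvd (by omega) (h ▸ Finset.dvd_prod_of_mem P (Finset.mem_univ j)))
      (hP.three_le j)
  have hsub : ∀ i j : Fin t, i = j := fun i j => by
    by_contra hij
    have := hP.coprime hij
    rw [Function.onFun, h3, h3] at this
    exact absurd this (by decide)
  obtain rfl : t = 1 := by
    rcases t with _ | _ | t
    · simp [order] at h
    · rfl
    · exact absurd (hsub 0 1) (by simp)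
  obtain rfl : P = fun _ => 3 := funext h3
  let b : BlockIdx (fun _ : Fin 1 => 3) := Sum.inl ⟨0, ⟨0, by decide⟩⟩
  have hb : ∀ b', b' = b := by
    rintro (⟨j, ⟨i, hi⟩⟩ | ⟨⟨i, j⟩, hij⟩)
    · obtain rfl : j = 0 := Subsingleton.elim _ _
      simp only [Nat.reduceSub, Nat.reduceDiv] at hi
      obtain rfl : i = 0 := by omega
      rfl
    · exact absurd (Subsingleton.elim i j) hij.ne
  let f : BasisIdx (fun _ : Fin 1 => 3) ≃ Fin 3 :=
    { toFun := fun x => ⟨x.2.val, by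
        obtain ⟨b', k⟩ := x
        obtain rfl := hb b'
        exact k.2⟩
      invFun := fun k => ⟨b, k⟩
      left_inv := by
        rintro ⟨b', k⟩
        obtain rfl := hb b'
        rfl
      right_inv := fun k => rfl }
  refine ⟨f, fun x => rfl, ?_⟩
  ext i k
  refine (Matrix.blockDiagonal'_apply_eq (blockMat _) (k := b) i k).trans ?_
  change matN 3 (order _) i k = _
  rw [h]
  fin_cases i <;> fin_cases k <;> rfl

/-! ### Characteristic polynomials of the block matrices -/

section Charpoly
open Polynomial Matrix

theorem charpoly_blockDiagonal'_of_linearOrder {o : Type*} [Fintype o] [LinearOrder o] {m : o → Type*}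
    [∀ i, Fintype (m i)] [∀ i, DecidableEq (m i)] {R : Type*} [CommRing R]
    (M : ∀ i, Matrix (m i) (m i) R) : (blockDiagonal' M).charpoly = ∏ i, (M i).charpoly := by
  have h : ∀ a, ((blockDiagonal' M).toSquareBlock Sigma.fst a).charpoly = (M a).charpoly := by
    intro a
    let e : {x : Σ i, m i // x.1 = a} ≃ m a :=
      { toFun := fun x => x.2 ▸ x.1.2
        invFun := fun y => ⟨⟨a, y⟩, rfl⟩
        left_inv := by rintro ⟨⟨i, y⟩, rfl⟩; rfl
        right_inv := fun y => rfl }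
    rw [← charpoly_reindex e]
    congr 1
    ext i k
    exact blockDiagonal'_apply_eq M a i k
  rw [(blockTriangular_blockDiagonal' M).charpoly]
  rw [Finset.prod_congr rfl fun a _ => h a]
  refine Finset.prod_subset (Finset.subset_univ _) fun a _ ha => ?_
  have : IsEmpty (m a) := ⟨fun y => ha (Finset.mem_image.2 ⟨⟨a, y⟩, Finset.mem_univ _, rfl⟩)⟩
  exact det_isEmpty

/-- A block diagonal matrix is block triangular for any ordering of the blocks, so an arbitrary one
is chosen. -/
theorem charpoly_blockDiagonal' {o : Type*} [Fintype o] [DecidableEq o] {m : o → Type*}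
    [∀ i, Fintype (m i)] [∀ i, DecidableEq (m i)] {R : Type*} [CommRing R]
    (M : ∀ i, Matrix (m i) (m i) R) : (blockDiagonal' M).charpoly = ∏ i, (M i).charpoly := by
  let : LinearOrder o := LinearOrder.lift' (Fintype.equivFin o) (Equiv.injective _)
  convert charpoly_blockDiagonal'_of_linearOrder M

theorem matM_pow (z m : ℕ) : matM z ^ m =
    Matrix.of fun i k => if i.val = (k.val + m) % z then (1 : ℤ) else 0 := by
  induction m with
  | zero =>
    ext i k
    simp [Matrix.one_apply, Nat.mod_eq_of_lt k.2, Fin.ext_iff]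
  | succ m ih =>
    ext i k
    have hz : 0 < z := k.pos
    rw [pow_succ, ih, Matrix.mul_apply,
      Finset.sum_eq_single ⟨(k.val + 1) % z, Nat.mod_lt _ hz⟩]
    · simp [matM, Nat.add_assoc, Nat.add_comm 1]
    · intro l _ hl
      have : l.val ≠ (k.val + 1) % z := fun e => hl (Fin.ext e)
      simp [matM, this]
    · simp

/-- The difference `d` of the two polynomials has degree below `z` and annihilates the matrix.
Applied to the first standard vector, the powers of the matrix with exponents below `z` give the
distinct standard vectors, so all coefficients of `d` vanish. -/
theorem charpoly_matM {z : ℕ} (hz : 0 < z) : (matM z).charpoly = X ^ z - 1 := by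
  rw [← sub_eq_zero]
  set d := (matM z).charpoly - (X ^ z - 1) with hd
  have hm : matM z ^ z = 1 := by
    rw [matM_pow, ← pow_zero (matM z), matM_pow]
    simp
  have h0 : aeval (matM z) d = 0 := by
    rw [hd, map_sub, Matrix.aeval_self_charpoly]
    simp [hm]
  have hdeg : d.degree < z := by
    have hc : (matM z).charpoly.degree = z := by
      rw [Matrix.charpoly_degree_eq_dim, Fintype.card_fin]
    have hx : (X ^ z - 1 : ℤ[X]).degree = z := by
      rw [← C_1]; exact degree_X_pow_sub_C hz 1
    rw [← hc]
    refine degree_sub_lt_left (by rw [hc, hx]) (Matrix.charpoly_monic _).ne_zero ?_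
    rw [Matrix.charpoly_monic, ← C_1, leadingCoeff_X_pow_sub_C hz]
  have hnat : d.natDegree < z := by
    by_cases h : d = 0
    · rwa [h, natDegree_zero]
    · exact (natDegree_lt_iff_degree_lt h).2 hdeg
  rw [aeval_eq_sum_range' hnat] at h0
  ext i
  by_cases hi : i < z
  · have h1 := congrFun (congrFun h0 ⟨i, hi⟩) ⟨0, hz⟩
    rw [Matrix.sum_apply, Finset.sum_eq_single i] at h1
    · simpa [matM_pow, Nat.mod_eq_of_lt hi] using h1
    · intro m hm hmi
      rw [Finset.mem_range] at hm
      simp [matM_pow, Nat.mod_eq_of_lt hm, hmi.symm]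
    · simp [hi]
  · rw [coeff_eq_zero_of_degree_lt (hdeg.trans_le (by exact_mod_cast not_lt.1 hi)), coeff_zero]

/-- The matrix that intertwines `matN` and `matM`. -/
def intertwiner (z : ℕ) (q : ℤ) : Matrix (Fin z) (Fin z) ℤ :=
  Matrix.of fun i k =>
    if k.val = 0 then (if i.val = 0 then q else -1) else if i = k then 1 else 0

theorem det_intertwiner {z : ℕ} (hz : 0 < z) (q : ℤ) : (intertwiner z q).det = q := by
  obtain ⟨z, rfl⟩ : ∃ y, z = y + 1 := ⟨z - 1, by omega⟩
  rw [Matrix.det_of_isLowerTriangular, Fin.prod_univ_succ]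
  · simp [intertwiner]
  · intro i k hik
    have h : i < k := hik
    have h0 : k ≠ 0 := ((Fin.zero_le i).trans_lt h).ne'
    simp [intertwiner, h.ne, h0]

/-- The columns of the intertwiner are the vectors `2 q` times the pairs of the orbit, written in
the basis in which the orbit sum divided by `q` replaces the pair at position 0. The rotation
permutes these vectors cyclically and has matrix N in that basis. -/
theorem matN_mul_intertwiner {z : ℕ} (hz : 3 ≤ z) (q : ℤ) :
    matN z q * intertwiner z q = intertwiner z q * matM z := by
  ext i k
  have hR : (intertwiner z q * matM z) i k =
      intertwiner z q i ⟨(k.val + 1) % z, Nat.mod_lt _ (by omega)⟩ := by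
    rw [Matrix.mul_apply, Finset.sum_eq_single ⟨(k.val + 1) % z, Nat.mod_lt _ (by omega)⟩]
    · simp [matM]
    · intro l _ hl
      have : l.val ≠ (k.val + 1) % z := fun e => hl (Fin.ext e)
      simp [matM, this]
    · simp
  rw [hR]
  have hi := i.2
  by_cases hk : k.val = 0
  -- At most three terms of column 0 survive: the last column of N, its first column, and the
  -- subdiagonal 1 in row `i`. The guard `2 ≤ i` excludes rows 0 and 1, where `i - 1` is 0 and
  -- column 0 of N has no subdiagonal entry. The sum is the second standard vector.
  · have h1 : ∀ l : Fin z, matN z q i l * intertwiner z q l k =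
        (if l = ⟨z - 1, by omega⟩ then (if i.val = 0 then -q else 1) else 0) +
        (if l = ⟨0, by omega⟩ then (if i.val = 0 then q else 0) else 0) +
        (if l = ⟨i.val - 1, by omega⟩ then (if 2 ≤ i.val then -1 else 0) else 0) := by
      intro l
      have hl := l.2
      simp only [matN, intertwiner, Matrix.of_apply, hk, if_true, Fin.ext_iff]
      split_ifs <;> first | contradiction | omega
    rw [Matrix.mul_apply, Finset.sum_congr rfl fun l _ => h1 l, Finset.sum_add_distrib,
      Finset.sum_add_distrib]
    simp only [Finset.sum_ite_eq', Finset.mem_univ, if_true]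
    have e : (⟨(k.val + 1) % z, Nat.mod_lt _ (by omega)⟩ : Fin z) = ⟨1, by omega⟩ :=
      Fin.ext (by simp only [hk, zero_add]; exact Nat.mod_eq_of_lt (by omega))
    rw [e]
    simp only [intertwiner, Matrix.of_apply, Fin.ext_iff]
    split_ifs <;> first | contradiction | omega
  · rw [Matrix.mul_apply, Finset.sum_eq_single k]
    · rcases Nat.lt_or_ge (k.val + 1) z with h | h
      · simp only [matN, intertwiner, Matrix.of_apply, Fin.ext_iff, Nat.mod_eq_of_lt h]
        split_ifs <;> first | contradiction | omega
      · have : k.val + 1 = z := by omega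
        simp only [matN, intertwiner, Matrix.of_apply, Fin.ext_iff, this, Nat.mod_self]
        split_ifs <;> first | contradiction | omega
    · intro l _ hl
      simp [intertwiner, hk, hl]
    · simp

/-- The determinant of `T` need not be a unit: it is cancelled in the polynomial ring, which is a
domain. This matters because the intertwiner has determinant `q`. -/
theorem charpoly_eq_of_mul_eq {m R : Type*} [Fintype m] [DecidableEq m] [CommRing R] [IsDomain R]
    {A B T : Matrix m m R} (hT : T.det ≠ 0) (h : A * T = T * B) : A.charpoly = B.charpoly := by
  have h1 : A.charmatrix * C.mapMatrix T = C.mapMatrix T * B.charmatrix := by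
    rw [charmatrix, charmatrix, sub_mul, mul_sub, ← map_mul, ← map_mul, h,
      (Matrix.scalar_commute X (fun r => Commute.all _ _) _).eq]
  have h2 := congrArg Matrix.det h1
  rw [Matrix.det_mul, Matrix.det_mul, ← RingHom.map_det, mul_comm] at h2
  exact mul_left_cancel₀ (by simpa using hT) h2

theorem charpoly_matN {z : ℕ} (hz : 3 ≤ z) {q : ℤ} (hq : q ≠ 0) :
    (matN z q).charpoly = X ^ z - 1 := by
  rw [← charpoly_matM (by omega)]
  exact charpoly_eq_of_mul_eq (by rwa [det_intertwiner (by omega)]) (matN_mul_intertwiner hz q)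

variable {t : ℕ} {P : Fin t → ℕ}

theorem prod_blockIdx {M : Type*} [CommMonoid M] (f : ℕ → M) :
    ∏ b : BlockIdx P, f (blockSize P b) = (∏ j : Fin t, f (P j) ^ ((P j - 1) / 2)) *
      ∏ j : Fin t, ∏ h ∈ Finset.Ioi j, f (P j * P h) := by
  rw [Fintype.prod_sum_type, Fintype.prod_sigma]
  congr 1
  · simp [blockSize]
  · refine (Finset.prod_subtype (Finset.univ.filter fun x : Fin t × Fin t => x.1 < x.2)
      (p := fun x => x.1 < x.2) (by simp) fun x => f (P x.1 * P x.2)).symm.trans ?_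
    rw [Finset.prod_filter, Fintype.prod_prod_type]
    refine Finset.prod_congr rfl fun j _ => ?_
    rw [← Finset.prod_filter]
    refine Finset.prod_congr ?_ fun _ _ => rfl
    ext h
    simp

variable [∀ j, NeZero (P j)]

theorem charpoly_blockMat (hP : OddCoprime P) (b : BlockIdx P) :
    (blockMat P b).charpoly = X ^ blockSize P b - 1 := by
  have hpos : ∀ j, 0 < P j := fun j => Nat.pos_of_ne_zero (NeZero.ne _)
  rcases b with ⟨j, h⟩ | x
  · by_cases h0 : h.val = 0
    · have e : blockMat P (Sum.inl ⟨j, h⟩) = matN (P j) (order P) := if_pos h0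
      exact (congrArg Matrix.charpoly e).trans (charpoly_matN (hP.three_le j) (order_ne_zero P))
    · have e : blockMat P (Sum.inl ⟨j, h⟩) = matM (P j) := if_neg h0
      exact (congrArg Matrix.charpoly e).trans (charpoly_matM (hpos j))
  · exact charpoly_matM (z := P x.1.1 * P x.1.2) (Nat.mul_pos (hpos _) (hpos _))

end Charpoly
end BraidHolonomy

/-! ### The theorem for powers of distinct odd primes -/

open BraidHolonomy Polynomial in

theorem theorem4p1 {t : ℕ} (p r P : Fin t → ℕ)
    (hp : ∀ i, (p i).Prime) (hodd : ∀ i, Odd (p i)) (hinj : Function.Injective p)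
    (hr : ∀ i, 1 ≤ r i) (hP : ∀ i, P i = p i ^ r i) :
    -- the lattice has rank `n (n - 1) / 2`
    Module.Free ℤ (Additive (lattice P)) ∧
    Module.finrank ℤ (Additive (lattice P)) = strands P * (strands P - 1) / 2 ∧
    -- the holonomy representation is faithful
    Function.Injective (holonomyRep P) ∧
    -- the elements `e_{j,h,k}` form a basis `B` of the lattice, and `θ`, the image of `δ`,
    -- generates the holonomy group, which is cyclic of order `q`
    ∃ (B : Module.Basis (BasisIdx P) ℤ (Additive (lattice P))) (θ : Holonomy P),
      (∀ x : BasisIdx P,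
        (((Additive.toMul (B x) : lattice P) : Gam P) : CrystBraid (strands P)) =
          basisElt P x.1 x.2.val) ∧
      holonomyPerm P θ = crystPerm (strands P) (delta P) ∧
      (∀ g : Holonomy P, g ∈ Subgroup.zpowers θ) ∧
      Nat.card (Holonomy P) = order P ∧
      -- the matrix of `ψ_q(θ)`, its shape for `q = 3`, and its characteristic polynomial
      LinearMap.toMatrix B B (holonomyRep P θ) = Matrix.blockDiagonal' (blockMat P) ∧
      (order P = 3 → ∃ f : BasisIdx P ≃ Fin 3, (∀ x, (f x).val = x.2.val) ∧
        Matrix.reindex f f (LinearMap.toMatrix B B (holonomyRep P θ)) =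
          !![1, 0, 3; 0, 0, -1; 0, 1, -1]) ∧
      (LinearMap.toMatrix B B (holonomyRep P θ)).charpoly =
        (∏ j : Fin t, (X ^ P j - 1 : ℤ[X]) ^ ((P j - 1) / 2)) *
          ∏ j : Fin t, ∏ h ∈ Finset.Ioi j, (X ^ (P j * P h) - 1 : ℤ[X]) := by
  have hP' : OddCoprime P :=
    { odd := fun j => hP j ▸ (hodd j).pow
      three_le := fun j => by
        have h2 := (hp j).two_le
        have h3 : p j ≠ 2 := fun h => absurd (hodd j) (by rw [h]; decide)
        have h4 : p j ≤ p j ^ r j := Nat.le_self_pow (by have := hr j; omega) _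
        rw [hP]
        omega
      coprime := fun i j hij => by
        rw [Function.onFun, hP, hP]
        exact Nat.Coprime.pow _ _ ((Nat.coprime_primes (hp i) (hp j)).2 fun h => hij (hinj h)) }
  have hne : ∀ j, NeZero (P j) := fun j => ⟨by have := hP'.three_le j; omega⟩
  have hM := toMatrix_holonomyRep hP'
  refine ⟨Module.Free.of_basis (latticeBasis hP'), ?_, holonomyRep_injective hP',
    latticeBasis hP', theta P, ?_, holonomyPerm_theta hP', mem_zpowers_theta hP',
    card_holonomy hP', hM, ?_, ?_⟩
  · rw [Module.finrank_eq_card_basis (latticeBasis hP'), card_basisIdx hP']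
  · intro x
    rw [latticeBasis_apply]
    rfl
  · intro h
    rw [hM]
    exact exists_reindex_blockDiagonal'_of_order_eq_three hP' h
  · rw [hM, charpoly_blockDiagonal', Finset.prod_congr rfl fun b _ => charpoly_blockMat hP' b]
    exact prod_blockIdx fun z => (X ^ z - 1 : ℤ[X])
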